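/- Let $M$ be a connected smooth manifold with a smooth Riemannian metric $h$ and a smooth one-form $\omega$, let $\alpha:\mathbb R\to(0,\infty)$ be smooth, and let $V=\mathbb R\times M$ carry a smooth Lorentzian metric $g=-dt^2+\omega_t\otimes dt+dt\otimes\omega_t+h_t$, where $\omega_t$ and $h_t$ are a one-form and a symmetric bilinear form on $M$ depending smoothly on $t$. Put $$g_{cl}=-dt^2+\omega\otimes dt+dt\otimes\omega+h,\qquad g_{op}=-dt^2+\alpha(t)\,\omega\otimes dt+\alpha(t)\,dt\otimes\omega+\alpha(t)^2h ,$$ all time-oriented by $\partial_t$. Assume $g_{cl}\prec_0 g\prec_0 g_{op}$, where $g\prec_0 g'$ means that every future-directed causal vector of $g$ is a future-directed causal vector of $g'$. Notation. $I^-$ is the chronological past for $g$. A past set is a non-empty $P\subset V$ with $P=I^-(P)$; it is indecomposable (an IP) if it is not the union of two proper past subsets. $\hat\partial V$ is the set of terminal IPs (TIPs) of $(V,g)$, i.e. of the IPs that are not of the form $I^-(p)$, $p\in V$; write $i^+=V$. Let $d^+$ be the generalized distance of the Randers metric $F^+(v)=\sqrt{h(v,v)+\omega(v)^2}+\omega(v)$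 (infimum of lengths of piecewise smooth curves). A sequence is forward Cauchy if for each $\varepsilon>0$ there is $n_0$ with $d^+(x_n,x_m)<\varepsilon$ whenever $n_0\le n\le m$. $M_C^+$ is the set of forward Cauchy sequences modulo $(x_n)\sim(x'_n)\iff\lim_n\lim_m d^+(x_n,x'_m)=\lim_n\lim_m d^+(x'_n,x_m)=0$; $M\subset M_C^+$ by constant sequences, $\partial_C^+M=M_C^+\setminus M$, and $d_Q^+(y,[(x_n)])=\lim_n d^+(y,x_n)$ for $y\in M$. Let $B^+(M)$ be the set of finite Busemann functions $b_c(y)=\lim_{t\to\Omega}(t-d^+(y,c(t)))$, where $c:[a,\Omega)\to M$, $a<\Omega\le\infty$, is smooth with $F^+(\dot c)<1$. Put $M_B^+=B^+(M)/\mathbb R$ (functions modulo additive constants); $M_C^+$ is regarded as a subset of $M_B^+$ through $x\mapsto[\Omega-d_Q^+(\cdot,x)]$, $\partial_B^+M=M_B^+\setminus M$, and $\partial_{\mathcal B}^+M=\partial_B^+M\setminus\partial_C^+M$. For $f:M\to\mathbb R$ put $P_{cl}(f)=\{(t,y)\in V: t<f(y)\}$. $(M,d^+)$ is bounded if $M=\{y:d^+(x_0,y)<r\}$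 for some $x_0\in M$, $r<\infty$, and complete if every forward Cauchy sequence converges in $M$. Then: (1) If $(M,d^+)$ is bounded, then $\partial_{\mathcal B}^+M=\emptyset$ and $\hat\partial V$ contains a point set cone with base $\partial_C^+M$ and apex $i^+$: $i^+$ and all the sets $I^-\big(P_{cl}(\Omega-d_Q^+(\cdot,x))\big)$, $(\Omega,x)\in\mathbb R\times\partial_C^+M$, belong to $\hat\partial V$ and are pairwise distinct. If, in addition, $(M,d^+)$ is complete, then $M$ is compact and $\hat\partial V=\{i^+\}$. (2) If $(M,d^+)$ is complete and $\int_0^\infty\big(\frac1{\alpha(s)}-1\big)\,ds<\infty$, then $\partial_C^+M=\emptyset$ and $\hat\partial V$ contains a point set cone with base $\partial_{\mathcal B}^+M$ and apex $i^+$: for every choice of representatives $b_\xi\in B^+(M)$ of the classes $\xi\in\partial_{\mathcal B}^+M$, the set $i^+$ and all the sets $I^-\big(P_{cl}(b_\xi+k)\big)$, $(k,\xi)\in\mathbb R\times\partial_{\mathcal B}^+M$, belong to $\hat\partial V$ and are pairwise distinct. -/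

import Mathlib

open Set Filter Topology
open scoped Manifold ContDiff ENNReal NNReal

noncomputable section

namespace Isocausal

/-! ### Metrics on `ℝ × M` of the form `-dt² + ω_t ⊗ dt + dt ⊗ ω_t + h_t` -/

section Spacetime

variable {n : ℕ} {M : Type*} [TopologicalSpace M] [ChartedSpace (EuclideanSpace ℝ (Fin n)) M]

/-- The coefficients `ω_t` (`oneForm`) and `h_t` (`h`) of a field of bilinear forms
`g = -dt² + ω_t ⊗ dt + dt ⊗ ω_t + h_t` on `ℝ × M`. Whether `g` is a smooth Lorentzian metric is
expressed by `SplitMetric.IsSpacetime`. -/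
structure SplitMetric (n : ℕ) (M : Type*) [TopologicalSpace M]
    [ChartedSpace (EuclideanSpace ℝ (Fin n)) M] where
  oneForm : ℝ → (x : M) → (TangentSpace (𝓡 n) x →L[ℝ] ℝ)
  h : ℝ → (x : M) → (TangentSpace (𝓡 n) x →L[ℝ] TangentSpace (𝓡 n) x →L[ℝ] ℝ)

/-- The value of `g` at the event `(t, x)` on the tangent vectors `a ∂_t + v` and `b ∂_t + w`,
where `T_{(t,x)}(ℝ × M) = ℝ × T_x M`. -/
def SplitMetric.val (g : SplitMetric n M) (t : ℝ) (x : M)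
    (a : ℝ) (v : TangentSpace (𝓡 n) x) (b : ℝ) (w : TangentSpace (𝓡 n) x) : ℝ :=
  -(a * b) + g.oneForm t x v * b + a * g.oneForm t x w + g.h t x v w

/-- `g` is a smooth Lorentzian metric on `ℝ × M`: its coefficients are smooth on `ℝ × M`, it is
symmetric, and it is positive definite on the `g`-orthogonal complement of `∂_t`
(which satisfies `g(∂_t, ∂_t) = -1`). -/
structure SplitMetric.IsSpacetime [IsManifold (𝓡 n) ∞ M] (g : SplitMetric n M) : Prop where
  smooth_oneForm : ContMDiff (𝓘(ℝ, ℝ).prod (𝓡 n))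
    ((𝓡 n).prod 𝓘(ℝ, EuclideanSpace ℝ (Fin n) →L[ℝ] ℝ)) ∞
    (fun p : ℝ × M => Bundle.TotalSpace.mk' (EuclideanSpace ℝ (Fin n) →L[ℝ] ℝ)
      (E := fun x : M => TangentSpace (𝓡 n) x →L[ℝ] ℝ) p.2 (g.oneForm p.1 p.2))
  smooth_h : ContMDiff (𝓘(ℝ, ℝ).prod (𝓡 n))
    ((𝓡 n).prod 𝓘(ℝ, EuclideanSpace ℝ (Fin n) →L[ℝ] EuclideanSpace ℝ (Fin n) →L[ℝ] ℝ)) ∞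
    (fun p : ℝ × M => Bundle.TotalSpace.mk'
      (EuclideanSpace ℝ (Fin n) →L[ℝ] EuclideanSpace ℝ (Fin n) →L[ℝ] ℝ)
      (E := fun x : M => TangentSpace (𝓡 n) x →L[ℝ] TangentSpace (𝓡 n) x →L[ℝ] ℝ)
      p.2 (g.h p.1 p.2))
  symm : ∀ (t : ℝ) (x : M) (v w : TangentSpace (𝓡 n) x), g.h t x v w = g.h t x w v
  lorentzian : ∀ (t : ℝ) (x : M) (a : ℝ) (v : TangentSpace (𝓡 n) x),
    ¬ (a = 0 ∧ v = 0) → g.val t x 1 0 a v = 0 → 0 < g.val t x a v a v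

/-- `a ∂_t + v` is a future-directed causal vector; the time orientation is the one of `∂_t`. -/
def SplitMetric.FutureCausal (g : SplitMetric n M) (t : ℝ) (x : M)
    (a : ℝ) (v : TangentSpace (𝓡 n) x) : Prop :=
  ¬ (a = 0 ∧ v = 0) ∧ g.val t x a v a v ≤ 0 ∧ g.val t x 1 0 a v < 0

/-- `a ∂_t + v` is a future-directed timelike vector. -/
def SplitMetric.FutureTimelike (g : SplitMetric n M) (t : ℝ) (x : M)
    (a : ℝ) (v : TangentSpace (𝓡 n) x) : Prop :=
  g.val t x a v a v < 0 ∧ g.val t x 1 0 a v < 0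

/-- `g ≺₀ g'`: the identity is a causal mapping, that is, every future-directed causal vector of
`g` is a future-directed causal vector of `g'` (the cones of `g'` are wider). -/
def SplitMetric.Prec (g g' : SplitMetric n M) : Prop :=
  ∀ (t : ℝ) (x : M) (a : ℝ) (v : TangentSpace (𝓡 n) x),
    g.FutureCausal t x a v → g'.FutureCausal t x a v

/-- There is a smooth future-directed timelike curve `s ↦ (τ s, c s)`, `s ∈ [a, b]`, from `p`
to `q`. -/
def SplitMetric.TimelikeSegment (g : SplitMetric n M) (p q : ℝ × M) : Prop :=
  ∃ (τ : ℝ → ℝ) (c : ℝ → M) (a b : ℝ), a < b ∧ (τ a, c a) = p ∧ (τ b, c b) = q ∧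
    ∀ s ∈ Icc a b, ContDiffAt ℝ ∞ τ s ∧ ContMDiffAt 𝓘(ℝ, ℝ) (𝓡 n) ∞ c s ∧
      g.FutureTimelike (τ s) (c s) (deriv τ s) (mfderiv 𝓘(ℝ, ℝ) (𝓡 n) c s (1 : ℝ))

/-- The chronological relation `p ≪ q`: there is a (piecewise smooth) future-directed timelike
curve from `p` to `q`, i.e. a finite concatenation of smooth ones. -/
def SplitMetric.Chron (g : SplitMetric n M) : ℝ × M → ℝ × M → Prop :=
  Relation.TransGen g.TimelikeSegment

/-- The chronological past `I⁻(S)` of a set of events. -/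
def SplitMetric.past (g : SplitMetric n M) (S : Set (ℝ × M)) : Set (ℝ × M) :=
  {p | ∃ q ∈ S, g.Chron p q}

/-- Past sets: non-empty sets with `P = I⁻(P)`. -/
def SplitMetric.IsPastSet (g : SplitMetric n M) (P : Set (ℝ × M)) : Prop :=
  P.Nonempty ∧ P = g.past P

/-- Indecomposable past sets: past sets that are not the union of two proper past subsets. -/
def SplitMetric.IsIP (g : SplitMetric n M) (P : Set (ℝ × M)) : Prop :=
  g.IsPastSet P ∧ ∀ A B : Set (ℝ × M), g.IsPastSet A → g.IsPastSet B → P = A ∪ B → A = P ∨ B = P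

/-- Terminal indecomposable past sets: the IPs that are not the past of any event. -/
def SplitMetric.IsTIP (g : SplitMetric n M) (P : Set (ℝ × M)) : Prop :=
  g.IsIP P ∧ ¬ ∃ p : ℝ × M, P = g.past {p}

/-- The future c-boundary: the set of all TIPs. -/
def SplitMetric.futureBoundary (g : SplitMetric n M) : Set (Set (ℝ × M)) :=
  {P | g.IsTIP P}

end Spacetime

/-! ### Standard stationary data, the metrics `g_cl`, `g_op`, and the Fermat distance `d⁺` -/

section Stationary

variable {n : ℕ} {M : Type*} [TopologicalSpace M] [ChartedSpace (EuclideanSpace ℝ (Fin n)) M]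
  [IsManifold (𝓡 n) ∞ M]

/-- A smooth Riemannian metric `h` and a smooth one-form `ω` (`oneForm`) on `M`. -/
structure StationaryData (n : ℕ) (M : Type*) [TopologicalSpace M]
    [ChartedSpace (EuclideanSpace ℝ (Fin n)) M] [IsManifold (𝓡 n) ∞ M] where
  h : Bundle.ContMDiffRiemannianMetric (𝓡 n) ∞ (EuclideanSpace ℝ (Fin n))
    (fun x : M => TangentSpace (𝓡 n) x)
  oneForm : (x : M) → (TangentSpace (𝓡 n) x →L[ℝ] ℝ)
  smooth_oneForm : ContMDiff (𝓡 n) ((𝓡 n).prod 𝓘(ℝ, EuclideanSpace ℝ (Fin n) →L[ℝ] ℝ)) ∞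
    (fun x : M => Bundle.TotalSpace.mk' (EuclideanSpace ℝ (Fin n) →L[ℝ] ℝ)
      (E := fun x : M => TangentSpace (𝓡 n) x →L[ℝ] ℝ) x (oneForm x))

namespace StationaryData

variable (D : StationaryData n M)

/-- `g_cl = -dt² + ω ⊗ dt + dt ⊗ ω + h`. -/
def gcl : SplitMetric n M where
  oneForm := fun _ x => D.oneForm x
  h := fun _ x => D.h.inner x

/-- `g_op = -dt² + α(t) ω ⊗ dt + α(t) dt ⊗ ω + α(t)² h`. -/
def gop (α : ℝ → ℝ) : SplitMetric n M where
  oneForm := fun t x => α t • D.oneForm x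
  h := fun t x => (α t) ^ 2 • D.h.inner x

/-- The Randers metric `F⁺(v) = √(h(v,v) + ω(v)²) + ω(v)`. -/
def F (x : M) (v : TangentSpace (𝓡 n) x) : ℝ :=
  Real.sqrt (D.h.inner x v v + (D.oneForm x v) ^ 2) + D.oneForm x v

/-- `D.HasCurve x y L`: some piecewise smooth curve from `x` to `y`, given as a finite
concatenation of smooth curves, has `F⁺`-length `L`. -/
inductive HasCurve : M → M → ℝ≥0∞ → Prop
  | nil (x : M) : HasCurve x x 0
  | cons (c : ℝ → M) (a b : ℝ) (y : M) (L : ℝ≥0∞) (hab : a ≤ b)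
      (hc : ∀ s ∈ Icc a b, ContMDiffAt 𝓘(ℝ, ℝ) (𝓡 n) ∞ c s)
      (hL : HasCurve (c b) y L) :
      HasCurve (c a) y
        ((∫⁻ s in Icc a b,
          ENNReal.ofReal (D.F (c s) (mfderiv 𝓘(ℝ, ℝ) (𝓡 n) c s (1 : ℝ)))) + L)

/-- The generalized distance `d⁺` of `F⁺`: the infimum of the lengths of the piecewise smooth
curves from `x` to `y`. -/
def dist (x y : M) : ℝ≥0∞ := sInf {L | D.HasCurve x y L}

variable {D} in
theorem HasCurve.trans {x y z : M} {L L' : ℝ≥0∞} (h : D.HasCurve x y L)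
    (h' : D.HasCurve y z L') : D.HasCurve x z (L + L') := by
  induction h with
  | nil x => simpa using h'
  | cons c a b y L hab hc _ ih =>
    rw [add_assoc]
    exact HasCurve.cons c a b z _ hab hc (ih h')

theorem dist_self (x : M) : D.dist x x = 0 :=
  le_antisymm (sInf_le (HasCurve.nil x)) bot_le

theorem dist_triangle (x y z : M) : D.dist x z ≤ D.dist x y + D.dist y z := by
  unfold dist
  rw [ENNReal.sInf_add]
  refine le_iInf₂ fun L hL => ?_
  rw [add_comm, ENNReal.sInf_add]
  refine le_iInf₂ fun L' hL' => ?_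
  rw [add_comm]
  exact sInf_le (HasCurve.trans hL hL')

/-! ### The forward Cauchy completion -/

/-- Forward Cauchy sequences of `(M, d⁺)`. -/
def IsCauchy (σ : ℕ → M) : Prop :=
  ∀ ε : ℝ≥0∞, 0 < ε → ∃ N, ∀ k m, N ≤ k → k ≤ m → D.dist (σ k) (σ m) < ε

/-- The type of all forward Cauchy sequences. -/
def Cau : Type _ := {σ : ℕ → M // D.IsCauchy σ}

/-- `lim_m d⁺(y, σ_m)`; for a forward Cauchy sequence `σ` the limit exists, see
`tendsto_limDist`. -/
def limDist (y : M) (σ : D.Cau) : ℝ≥0∞ := limsup (fun m => D.dist y (σ.1 m)) atTop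

theorem tendsto_limDist (y : M) (σ : D.Cau) :
    Tendsto (fun m => D.dist y (σ.1 m)) atTop (𝓝 (D.limDist y σ)) := by
  refine tendsto_of_le_liminf_of_limsup_le ?_ le_rfl
  refine ENNReal.le_of_forall_pos_le_add fun ε hε _ => ?_
  obtain ⟨N, hN⟩ := σ.2 ε (by exact_mod_cast hε)
  have key : ∀ k, N ≤ k → D.limDist y σ ≤ D.dist y (σ.1 k) + ε := fun k hk => by
    refine limsup_le_of_le (by isBoundedDefault) ?_
    filter_upwards [eventually_ge_atTop k] with m hm
    exact (D.dist_triangle y (σ.1 k) (σ.1 m)).trans (by gcongr; exact (hN k m hk hm).le)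
  have h2 : D.limDist y σ - ε ≤ liminf (fun m => D.dist y (σ.1 m)) atTop := by
    refine le_liminf_of_le (by isBoundedDefault) ?_
    filter_upwards [eventually_ge_atTop N] with m hm
    exact tsub_le_iff_right.2 (key m hm)
  exact tsub_le_iff_right.1 h2

/-- One half of the equivalence relation: `lim_k lim_m d⁺(σ_k, σ'_m) = 0`. -/
def CauLE (σ σ' : D.Cau) : Prop :=
  Tendsto (fun k => D.limDist (σ.1 k) σ') atTop (𝓝 0)

theorem limDist_le_of_cauLE {σ σ' : D.Cau} (h : D.CauLE σ σ') (y : M) :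
    D.limDist y σ' ≤ D.limDist y σ := by
  have h1 : Tendsto (fun k => D.dist y (σ.1 k) + D.limDist (σ.1 k) σ') atTop
      (𝓝 (D.limDist y σ + 0)) := (D.tendsto_limDist y σ).add h
  rw [add_zero] at h1
  refine ge_of_tendsto' h1 fun k => ?_
  exact le_of_tendsto_of_tendsto' (D.tendsto_limDist y σ')
    ((D.tendsto_limDist (σ.1 k) σ').const_add (D.dist y (σ.1 k)))
    fun m => D.dist_triangle _ _ _

theorem CauLE.refl (σ : D.Cau) : D.CauLE σ σ := by
  refine ENNReal.tendsto_nhds_zero.2 fun ε hε => ?_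
  obtain ⟨N, hN⟩ := σ.2 ε hε
  filter_upwards [eventually_ge_atTop N] with k hk
  refine limsup_le_of_le (by isBoundedDefault) ?_
  filter_upwards [eventually_ge_atTop k] with m hm
  exact (hN k m hk hm).le

theorem CauLE.trans {σ σ' σ'' : D.Cau} (h : D.CauLE σ σ') (h' : D.CauLE σ' σ'') :
    D.CauLE σ σ'' :=
  tendsto_of_tendsto_of_tendsto_of_le_of_le tendsto_const_nhds h (fun _ => bot_le)
    fun _ => D.limDist_le_of_cauLE h' _

/-- Two forward Cauchy sequences are related if both iterated limits of the distances vanish. -/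
instance cauSetoid : Setoid D.Cau where
  r σ σ' := D.CauLE σ σ' ∧ D.CauLE σ' σ
  iseqv := ⟨fun σ => ⟨CauLE.refl D σ, CauLE.refl D σ⟩, fun h => ⟨h.2, h.1⟩,
    fun h h' => ⟨CauLE.trans D h.1 h'.1, CauLE.trans D h'.2 h.2⟩⟩

/-- The forward Cauchy completion `M_C⁺`. -/
def CauchyCompletion : Type _ := Quotient D.cauSetoid

/-- The inclusion `M ↪ M_C⁺` by constant sequences. -/
def ofPoint (x : M) : D.CauchyCompletion :=
  Quotient.mk D.cauSetoid ⟨fun _ => x, fun ε hε => ⟨0, fun _ _ _ _ => by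
    rw [D.dist_self]; exact hε⟩⟩

/-- The forward Cauchy boundary `∂_C⁺ M = M_C⁺ \ M`. -/
def cauchyBoundary : Set D.CauchyCompletion := (range D.ofPoint)ᶜ

/-- The extension `d_Q⁺(y, ·)` of `d⁺(y, ·)` to `M_C⁺`, for `y ∈ M`. -/
def distQ (y : M) : D.CauchyCompletion → ℝ≥0∞ :=
  Quotient.lift (D.limDist y) fun _ _ h =>
    le_antisymm (D.limDist_le_of_cauLE h.2 y) (D.limDist_le_of_cauLE h.1 y)

/-- `(M, d⁺)` is (forward) bounded: `M` is a forward ball of finite radius. -/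
def IsBounded : Prop := ∃ (x₀ : M) (r : ℝ≥0), ∀ y : M, D.dist x₀ y < r

/-- `(M, d⁺)` is (forward) complete: forward Cauchy sequences converge in `M`. -/
def IsComplete : Prop := ∀ σ : ℕ → M, D.IsCauchy σ → ∃ x : M, Tendsto σ atTop (𝓝 x)

/-! ### Busemann functions -/

/-- `f` is the Busemann function of the curve `c` on `[a, Ω)`, where `s ∈ U` stands for `s < Ω`
and the filter `l` for `t → Ω`: the curve `t ↦ (t, c(t))` is future-directed timelike for `g_cl`,
i.e. `F⁺(c'(t)) < 1`, and `f = lim_{t → Ω} (t - d⁺(·, c(t)))`. -/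
def IsBusemannAlong (a : ℝ) (U : Set ℝ) (l : Filter ℝ) (c : ℝ → M) (f : M → ℝ) : Prop :=
  (∀ s ∈ U, a ≤ s → ContMDiffAt 𝓘(ℝ, ℝ) (𝓡 n) ∞ c s ∧
    D.F (c s) (mfderiv 𝓘(ℝ, ℝ) (𝓡 n) c s (1 : ℝ)) < 1) ∧
  ∀ y : M, Tendsto (fun t => t - (D.dist y (c t)).toReal) l (𝓝 (f y))

/-- `f` is a finite forward Busemann function of `g_cl`, for some curve on `[a, Ω)` with
`Ω < ∞` or `Ω = ∞`. -/
def IsBusemann (f : M → ℝ) : Prop :=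
  (∃ (a Ω : ℝ) (c : ℝ → M), a < Ω ∧ D.IsBusemannAlong a (Iio Ω) (𝓝[<] Ω) c f) ∨
  ∃ (a : ℝ) (c : ℝ → M), D.IsBusemannAlong a univ atTop c f

/-- The set `B⁺(M)` of the finite forward Busemann functions. -/
def BusemannFun : Type _ := {f : M → ℝ // D.IsBusemann f}

/-- Equality of Busemann functions up to an additive constant. -/
instance busSetoid : Setoid D.BusemannFun where
  r f f' := ∃ k : ℝ, ∀ y, f'.1 y = f.1 y + k
  iseqv := ⟨fun _ => ⟨0, fun _ => (add_zero _).symm⟩,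
    fun ⟨k, hk⟩ => ⟨-k, fun y => by rw [hk y]; ring⟩,
    fun ⟨k, hk⟩ ⟨k', hk'⟩ => ⟨k + k', fun y => by rw [hk' y, hk y]; ring⟩⟩

/-- The forward Busemann completion `M_B⁺ = B⁺(M) / ℝ`. -/
def BusemannCompletion : Type _ := Quotient D.busSetoid

/-- The function `d⁺_{(Ω,x)} = Ω - d_Q⁺(·, x)` for `x ∈ M_C⁺`. -/
def cauchyFun (Ω : ℝ) (x : D.CauchyCompletion) (y : M) : ℝ := Ω - (D.distQ y x).toReal

/-- The class `ξ ∈ M_B⁺` is the one of the functions `d⁺_{(Ω,x)}`, `Ω ∈ ℝ`; this is how `M_C⁺`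
(hence `M`) is regarded as a subset of `M_B⁺`. -/
def Represents (x : D.CauchyCompletion) (ξ : D.BusemannCompletion) : Prop :=
  ∃ (f : D.BusemannFun) (Ω : ℝ), Quotient.mk D.busSetoid f = ξ ∧ ∀ y, f.1 y = D.cauchyFun Ω x y

/-- The forward Busemann boundary `∂_B⁺ M = M_B⁺ \ M`. -/
def busemannBoundary : Set D.BusemannCompletion := {ξ | ¬ ∃ x : M, D.Represents (D.ofPoint x) ξ}

/-- The forward proper Busemann boundary `∂_𝓑⁺ M = ∂_B⁺ M \ ∂_C⁺ M`. -/
def properBusemannBoundary : Set D.BusemannCompletion :=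
  D.busemannBoundary \ {ξ | ∃ x ∈ D.cauchyBoundary, D.Represents x ξ}

end StationaryData

/-- The subset `P_cl(f) = {(t, y) : t < f(y)}` of `ℝ × M`; for a Busemann function `f` of `g_cl`
it is the corresponding IP of `g_cl`. -/
def pastOf {M : Type*} (f : M → ℝ) : Set (ℝ × M) := {p | p.1 < f p.2}

/-- The point set cone with base `B`: the cylinder `ℝ × B` together with an apex `none`. -/
abbrev PointCone (B : Type*) : Type _ := Option (ℝ × B)

/-- The map from the cone with base `B` to sets of events that takes the apex to `i⁺ = ℝ × M` and
the point `(k, ξ)` to the `g`-past `I⁻(P_cl(φ k ξ))` of the set `P_cl(φ k ξ)`. -/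
def coneMap {n : ℕ} {M : Type*} [TopologicalSpace M] [ChartedSpace (EuclideanSpace ℝ (Fin n)) M]
    (g : SplitMetric n M) {B : Type*} (φ : ℝ → B → M → ℝ) : PointCone B → Set (ℝ × M)
  | none => univ
  | some (k, ξ) => g.past (pastOf (φ k ξ))

/-- `coneMap g φ` embeds, as a point set, the cone with base `B` and apex `i⁺` into the future
c-boundary of `g`. -/
def ContainsCone {n : ℕ} {M : Type*} [TopologicalSpace M]
    [ChartedSpace (EuclideanSpace ℝ (Fin n)) M]
    (g : SplitMetric n M) {B : Type*} (φ : ℝ → B → M → ℝ) : Prop :=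
  Function.Injective (coneMap g φ) ∧ ∀ z, coneMap g φ z ∈ g.futureBoundary

end Stationary

end Isocausal

end

/-!
Both comparisons `g_cl ≺₀ g ≺₀ g_op` become estimates between the chronological relation of `g`
and the generalized distance `d⁺`. A curve of `F⁺`-length less than `s - t` lifts to a timelike
curve of `g` (`SplitMetric.chron_of_dist_lt`), so `d⁺(x, y) < s - t` implies `(t, x) ≪ (s, y)`.
Conversely `(t, x) ≪ (s, y)` implies `t < s` and `d⁺(x, y) ≤ ∫ₜˢ 1/α`
(`SplitMetric.Chron.lt_and_dist_le`).

The functions `Ω - d_Q⁺(·, x)` and the Busemann functions are limits of functions `Tᵢ - d⁺(·, cᵢ)`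
for events `(Tᵢ, cᵢ)` that are approached from inside `P_cl(f)` (`IsAsymptotic`). The events
`(Tᵢ - ε, cᵢ)` show that `P_cl(f)` is directed for the chronological relation, so that
`I⁻(P_cl(f))` is an IP.

*The Cauchy part.* Inside `I⁻(P_cl(Ω - d_Q⁺(·, x)))` all times are less than `Ω`, and the
`d_Q⁺`-distance to `x` at time `t` is at most `∫ₜ^Ω 1/α + (Ω - t)`, which vanishes as `t → Ω`. Hence
an inclusion of two such sets compares the times and one half of the equivalence relation of forward
Cauchy sequences (`SplitMetric.le_and_cauLE_of_past_subset`), and the sets are pairwise distinct. As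
`I⁻((T, z))` is the set of the pair `(T, z)`, those belonging to boundary points are terminal. If
`M` is bounded, the limit defining a Busemann function is infinite for curves defined for all times,
and those of curves with bounded time belong to points of `M_C⁺`.

*The Busemann part.* At time `t ≥ 0` the set `I⁻(P_cl(f))` exceeds `P_cl(f)` by at most the tail
`∫ₜ^∞ |1/α - 1|` (`SplitMetric.le_add_tail`). It tends to zero, so an inclusion of two such sets
along unbounded times forces the inequality of the functions
(`SplitMetric.le_of_past_pastOf_subset`). Unbounded times also make the sets terminal.

*Bounded and complete.* A Hopf–Rinow argument shows that `M` is compact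
(`StationaryData.IsComplete.hasCompactBall`). A past set with unbounded times is everything, as `M`
is bounded. An IP `P` with bounded times is directed, and compactness gives a point `z` to which the
events of `P` accumulate as their times tend to the supremum `Ω`. Then `P = I⁻((Ω, z))`
(`SplitMetric.IsIP.eq_past_singleton`): the inclusion `P ⊆ I⁻((Ω, z))` needs the late events of `P`
to be moved into the past by a time bounded below, without losing the chronological relation to a
given event. For this, whole timelike curves are shifted by `δ e^{-K(t - t₀)}`, where `K` is a local
Lipschitz constant in time of the light cones of `g` (`SplitMetric.Chron.shift`).
-/

noncomputable section

namespace Isocausal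

/-! ### Future cones and slopes -/

theorem continuousAt_deriv_of_contDiffAt {τ : ℝ → ℝ} {s : ℝ} (h : ContDiffAt ℝ ∞ τ s) :
    ContinuousAt (deriv τ) s := by
  have h1 := (h.continuousAt_fderiv (by simp)).clm_apply (continuousAt_const (y := (1 : ℝ)))
  simpa using h1

section Metric

variable {n : ℕ} {M : Type*} [TopologicalSpace M] [ChartedSpace (EuclideanSpace ℝ (Fin n)) M]

/-- The Finsler-type function `F_t(v) = ω_t(v) + √(h_t(v,v) + ω_t(v)²)` of `g`: for a spacetime, the
vector `a ∂_t + v` at `(t, x)` is future-directed timelike precisely when `F_t(v) < a`. -/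
def SplitMetric.slope (g : SplitMetric n M) (t : ℝ) (x : M) (v : TangentSpace (𝓡 n) x) : ℝ :=
  g.oneForm t x v + Real.sqrt (g.h t x v v + g.oneForm t x v ^ 2)

theorem SplitMetric.slope_smul (g : SplitMetric n M) (t : ℝ) (x : M) (v : TangentSpace (𝓡 n) x)
    {r : ℝ} (hr : 0 ≤ r) : g.slope t x (r • v) = r * g.slope t x v := by
  simp only [slope, map_smul, smul_apply, smul_eq_mul]
  rw [show r * (r * g.h t x v v) + (r * g.oneForm t x v) ^ 2 =
    r ^ 2 * (g.h t x v v + g.oneForm t x v ^ 2) by ring, Real.sqrt_mul (sq_nonneg r),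
    Real.sqrt_sq hr]
  ring

@[simp] theorem SplitMetric.slope_zero (g : SplitMetric n M) (t : ℝ) (x : M) :
    g.slope t x 0 = 0 := by
  simp [slope]

variable [IsManifold (𝓡 n) ∞ M]

namespace SplitMetric

variable {g : SplitMetric n M}

/-- The vector `ω_t(v) ∂_t + v` is `g`-orthogonal to `∂_t`, and this is its square. -/
theorem IsSpacetime.disc_pos (hg : g.IsSpacetime) (t : ℝ) (x : M) {v : TangentSpace (𝓡 n) x}
    (hv : v ≠ 0) : 0 < g.h t x v v + g.oneForm t x v ^ 2 := by
  have := hg.lorentzian t x (g.oneForm t x v) v (fun h => hv h.2) (by simp [SplitMetric.val])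
  simp only [SplitMetric.val] at this
  nlinarith

theorem IsSpacetime.disc_nonneg (hg : g.IsSpacetime) (t : ℝ) (x : M)
    (v : TangentSpace (𝓡 n) x) : 0 ≤ g.h t x v v + g.oneForm t x v ^ 2 := by
  by_cases hv : v = 0
  · simp [hv]
  · exact (hg.disc_pos t x hv).le

theorem IsSpacetime.futureTimelike_iff (hg : g.IsSpacetime) {t : ℝ} {x : M} {a : ℝ}
    {v : TangentSpace (𝓡 n) x} : g.FutureTimelike t x a v ↔ g.slope t x v < a := by
  have h0 := hg.disc_nonneg t x v
  simp only [FutureTimelike, slope, SplitMetric.val]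
  simp only [map_zero, zero_mul, one_mul, add_zero, zero_apply]
  constructor
  · rintro ⟨h1, h2⟩
    have : Real.sqrt (g.h t x v v + g.oneForm t x v ^ 2) < a - g.oneForm t x v := by
      rw [Real.sqrt_lt' (by linarith)]
      nlinarith
    linarith
  · intro h
    have h1 := Real.sqrt_nonneg (g.h t x v v + g.oneForm t x v ^ 2)
    have h2 : Real.sqrt (g.h t x v v + g.oneForm t x v ^ 2) < a - g.oneForm t x v := by linarith
    rw [Real.sqrt_lt' (by linarith)] at h2
    constructor <;> nlinarith

theorem IsSpacetime.futureCausal_iff (hg : g.IsSpacetime) {t : ℝ} {x : M} {a : ℝ}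
    {v : TangentSpace (𝓡 n) x} :
    g.FutureCausal t x a v ↔ ¬ (a = 0 ∧ v = 0) ∧ g.slope t x v ≤ a := by
  have h0 := hg.disc_nonneg t x v
  simp only [FutureCausal, slope, SplitMetric.val]
  simp only [map_zero, zero_mul, one_mul, add_zero, zero_apply]
  refine and_congr_right fun hne => ?_
  constructor
  · rintro ⟨h1, h2⟩
    have : Real.sqrt (g.h t x v v + g.oneForm t x v ^ 2) ≤ a - g.oneForm t x v := by
      exact Real.sqrt_le_iff.2 ⟨by linarith, by nlinarith⟩
    linarith
  · intro h
    have h1 := Real.sqrt_nonneg (g.h t x v v + g.oneForm t x v ^ 2)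
    have h2 : Real.sqrt (g.h t x v v + g.oneForm t x v ^ 2) ≤ a - g.oneForm t x v := by linarith
    have h3 := Real.sq_sqrt h0
    refine ⟨by nlinarith, ?_⟩
    by_cases hv : v = 0
    · subst hv
      have : a ≠ 0 := fun h => hne ⟨h, rfl⟩
      simp at h ⊢
      exact lt_of_le_of_ne h this.symm
    · have := Real.sqrt_pos.2 (hg.disc_pos t x hv)
      linarith

section Smooth

variable {EN : Type*} [NormedAddCommGroup EN] [NormedSpace ℝ EN] {HN : Type*} [TopologicalSpace HN]
  {IN : ModelWithCorners ℝ EN HN} {N : Type*} [TopologicalSpace N] [ChartedSpace HN N]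
  {k : WithTop ℕ∞} {τ : N → ℝ} {b : N → M} {v : ∀ p, TangentSpace (𝓡 n) (b p)} {p : N}

theorem IsSpacetime.contMDiffAt_oneForm (hg : g.IsSpacetime) (hk : k ≤ (∞ : WithTop ℕ∞))
    (hτ : ContMDiffAt IN 𝓘(ℝ, ℝ) k τ p)
    (hv : ContMDiffAt IN ((𝓡 n).prod 𝓘(ℝ, EuclideanSpace ℝ (Fin n))) k
      (fun q => (⟨b q, v q⟩ : TangentBundle (𝓡 n) M)) p) :
    ContMDiffAt IN 𝓘(ℝ, ℝ) k (fun q => g.oneForm (τ q) (b q) (v q)) p := by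
  have hb : ContMDiffAt IN (𝓡 n) k b p := (Bundle.contMDiffAt_totalSpace.1 hv).1
  have key : ContMDiffAt IN ((𝓡 n).prod 𝓘(ℝ)) k
      (fun m ↦ Bundle.TotalSpace.mk' ℝ (E := Bundle.Trivial M ℝ) (b m)
        (g.oneForm (τ m) (b m) (v m))) p := by
    apply ContMDiffAt.clm_bundle_apply (F₁ := EuclideanSpace ℝ (Fin n))
    · exact ((hg.smooth_oneForm.of_le hk).contMDiffAt (x := (τ p, b p))).comp p (hτ.prodMk hb)
    · exact hv
  exact (Bundle.contMDiffAt_totalSpace.1 key).2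

theorem IsSpacetime.contMDiffAt_h (hg : g.IsSpacetime) (hk : k ≤ (∞ : WithTop ℕ∞))
    (hτ : ContMDiffAt IN 𝓘(ℝ, ℝ) k τ p)
    (hv : ContMDiffAt IN ((𝓡 n).prod 𝓘(ℝ, EuclideanSpace ℝ (Fin n))) k
      (fun q => (⟨b q, v q⟩ : TangentBundle (𝓡 n) M)) p) :
    ContMDiffAt IN 𝓘(ℝ, ℝ) k (fun q => g.h (τ q) (b q) (v q) (v q)) p := by
  have hb : ContMDiffAt IN (𝓡 n) k b p := (Bundle.contMDiffAt_totalSpace.1 hv).1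
  have key : ContMDiffAt IN ((𝓡 n).prod 𝓘(ℝ)) k
      (fun m ↦ Bundle.TotalSpace.mk' ℝ (E := Bundle.Trivial M ℝ) (b m)
        (g.h (τ m) (b m) (v m) (v m))) p := by
    apply ContMDiffAt.clm_bundle_apply₂ (F₁ := EuclideanSpace ℝ (Fin n))
      (F₂ := EuclideanSpace ℝ (Fin n))
    · exact ((hg.smooth_h.of_le hk).contMDiffAt (x := (τ p, b p))).comp p (hτ.prodMk hb)
    · exact hv
    · exact hv
  exact (Bundle.contMDiffAt_totalSpace.1 key).2

theorem IsSpacetime.contMDiffAt_slope (hg : g.IsSpacetime) (hk : k ≤ (∞ : WithTop ℕ∞))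
    (hτ : ContMDiffAt IN 𝓘(ℝ, ℝ) k τ p)
    (hv : ContMDiffAt IN ((𝓡 n).prod 𝓘(ℝ, EuclideanSpace ℝ (Fin n))) k
      (fun q => (⟨b q, v q⟩ : TangentBundle (𝓡 n) M)) p) (hp : v p ≠ 0) :
    ContMDiffAt IN 𝓘(ℝ, ℝ) k (fun q => g.slope (τ q) (b q) (v q)) p := by
  have h1 := hg.contMDiffAt_oneForm hk hτ hv
  have h2 := hg.contMDiffAt_h hk hτ hv
  have h3 : ContMDiffAt IN 𝓘(ℝ, ℝ) k
      (fun q => g.h (τ q) (b q) (v q) (v q) + g.oneForm (τ q) (b q) (v q) ^ 2) p :=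
    h2.add (h1.pow 2)
  exact h1.add (((Real.contDiffAt_sqrt (n := k) (hg.disc_pos _ _ hp).ne').contMDiffAt).comp p h3)

end Smooth

theorem IsSpacetime.continuousAt_slope (hg : g.IsSpacetime) {N : Type*} [TopologicalSpace N]
    {τ : N → ℝ} {b : N → M} {v : ∀ p, TangentSpace (𝓡 n) (b p)} {p : N} (hτ : ContinuousAt τ p)
    (hv : ContinuousAt (fun q => (⟨b q, v q⟩ : TangentBundle (𝓡 n) M)) p) :
    ContinuousAt (fun q => g.slope (τ q) (b q) (v q)) p := by
  -- the universal case: the slope as a function on `ℝ × TM`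
  have key : Continuous fun q : ℝ × TangentBundle (𝓡 n) M => g.slope q.1 q.2.1 q.2.2 := by
    have h1 : Continuous fun q : ℝ × TangentBundle (𝓡 n) M => g.oneForm q.1 q.2.1 q.2.2 := by
      refine continuous_iff_continuousAt.2 fun q => ?_
      exact (hg.contMDiffAt_oneForm (IN := 𝓘(ℝ, ℝ).prod (𝓡 n).tangent) (k := 0) bot_le
        contMDiffAt_fst contMDiffAt_snd).continuousAt
    have h2 : Continuous fun q : ℝ × TangentBundle (𝓡 n) M => g.h q.1 q.2.1 q.2.2 q.2.2 := by
      refine continuous_iff_continuousAt.2 fun q => ?_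
      exact (hg.contMDiffAt_h (IN := 𝓘(ℝ, ℝ).prod (𝓡 n).tangent) (k := 0) bot_le
        contMDiffAt_fst contMDiffAt_snd).continuousAt
    exact h1.add (Real.continuous_sqrt.comp (h2.add (h1.pow 2)))
  exact ContinuousAt.comp (f := fun q => (τ q, (⟨b q, v q⟩ : TangentBundle (𝓡 n) M)))
    key.continuousAt (hτ.prodMk hv)

end SplitMetric

/-- The velocity of a smooth curve depends continuously on the parameter. -/
theorem continuousAt_velocity {c : ℝ → M} {s : ℝ}
    (hc : ContMDiffAt 𝓘(ℝ, ℝ) (𝓡 n) ∞ c s) :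
    ContinuousAt (fun r => (⟨c r, mfderiv 𝓘(ℝ, ℝ) (𝓡 n) c r (1 : ℝ)⟩ : TangentBundle (𝓡 n) M))
      s := by
  have h1 := hc.mfderiv_const (m := 0) (by norm_num)
  have h2 : ContMDiffAt 𝓘(ℝ, ℝ) (𝓘(ℝ, ℝ).prod 𝓘(ℝ, ℝ)) 0
      (fun r : ℝ => (⟨r, (1 : ℝ)⟩ : TangentBundle 𝓘(ℝ, ℝ) ℝ)) s := by
    refine Bundle.contMDiffAt_totalSpace.2 ⟨contMDiffAt_id, ?_⟩
    simpa using contMDiffAt_const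
  exact (ContMDiffAt.clm_apply_of_inCoordinates (F₁ := ℝ) (E₁ := TangentSpace 𝓘(ℝ, ℝ))
    (b₁ := fun r : ℝ => r) (b₂ := c) (v := fun _ => (1 : ℝ)) h1 h2
    (hc.of_le bot_le)).continuousAt

namespace StationaryData

variable (D : StationaryData n M)

theorem gcl_isSpacetime : D.gcl.IsSpacetime where
  smooth_oneForm := D.smooth_oneForm.comp contMDiff_snd
  smooth_h := D.h.contMDiff.comp contMDiff_snd
  symm _ x v w := D.h.symm x v w
  lorentzian t x a v hne h := by
    simp only [SplitMetric.val, gcl] at h ⊢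
    simp only [map_zero, zero_mul, one_mul, add_zero, zero_apply] at h
    have ha : a = D.oneForm x v := by linarith
    have hv : v ≠ 0 := by
      rintro rfl
      simp at ha
      exact hne ⟨ha, rfl⟩
    have := D.h.pos x v hv
    rw [← ha]
    nlinarith [mul_self_nonneg a]

theorem slope_gcl (t : ℝ) (x : M) (v : TangentSpace (𝓡 n) x) : D.gcl.slope t x v = D.F x v :=
  add_comm _ _

theorem F_pos (x : M) {v : TangentSpace (𝓡 n) x} (hv : v ≠ 0) : 0 < D.F x v := by
  have h1 := D.h.pos x v hv
  have : |D.oneForm x v| < Real.sqrt (D.h.inner x v v + (D.oneForm x v) ^ 2) :=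
    Real.lt_sqrt_of_sq_lt (by rw [sq_abs]; linarith)
  have := neg_abs_le (D.oneForm x v)
  unfold F
  linarith

theorem F_zero (x : M) : D.F x 0 = 0 := by simp [F]

theorem F_nonneg (x : M) (v : TangentSpace (𝓡 n) x) : 0 ≤ D.F x v := by
  by_cases hv : v = 0
  · rw [hv, F_zero]
  · exact (D.F_pos x hv).le

theorem F_smul (x : M) (v : TangentSpace (𝓡 n) x) {r : ℝ} (hr : 0 ≤ r) :
    D.F x (r • v) = r * D.F x v := by
  rw [← D.slope_gcl 0, ← D.slope_gcl 0, SplitMetric.slope_smul _ _ _ _ hr]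

theorem continuousAt_F {N : Type*} [TopologicalSpace N]
    {b : N → M} {v : ∀ p, TangentSpace (𝓡 n) (b p)} {p : N}
    (hv : ContinuousAt (fun q => (⟨b q, v q⟩ : TangentBundle (𝓡 n) M)) p) :
    ContinuousAt (fun q => D.F (b q) (v q)) p := by
  have := D.gcl_isSpacetime.continuousAt_slope (τ := fun _ => 0) continuousAt_const hv
  simpa only [slope_gcl] using this

theorem continuousAt_F_velocity {c : ℝ → M} {s : ℝ} (hc : ContMDiffAt 𝓘(ℝ, ℝ) (𝓡 n) ∞ c s) :
    ContinuousAt (fun r => D.F (c r) (mfderiv 𝓘(ℝ, ℝ) (𝓡 n) c r (1 : ℝ))) s :=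
  D.continuousAt_F (continuousAt_velocity hc)

/-- The causality comparison `g_cl ≺₀ g` read on speeds. -/
theorem futureTimelike_of_prec {g : SplitMetric n M} (hg : g.IsSpacetime) (hcl : D.gcl.Prec g)
    {t : ℝ} {x : M} {a : ℝ} {v : TangentSpace (𝓡 n) x} (h : D.F x v < a) :
    g.FutureTimelike t x a v := by
  have hF := D.F_nonneg x v
  rw [hg.futureTimelike_iff]
  have h1 : D.gcl.FutureCausal t x ((a + D.F x v) / 2) v := by
    rw [D.gcl_isSpacetime.futureCausal_iff, slope_gcl]
    exact ⟨fun h' => by linarith [h'.1], by linarith⟩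
  have h2 := (hg.futureCausal_iff.1 (hcl _ _ _ _ h1)).2
  linarith

/-- The causality comparison `g ≺₀ g_op` read on speeds. -/
theorem mul_F_lt_of_prec {α : ℝ → ℝ} (hα_pos : ∀ t, 0 < α t) {g : SplitMetric n M}
    (hg : g.IsSpacetime) (hop : g.Prec (D.gop α)) {t : ℝ} {x : M} {a : ℝ}
    {v : TangentSpace (𝓡 n) x} (h : g.FutureTimelike t x a v) : α t * D.F x v < a := by
  -- a slightly slower timelike vector turns the resulting weak inequality into a strict one
  obtain ⟨a', ha', ha'a⟩ := exists_between (hg.futureTimelike_iff.1 h)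
  refine lt_of_le_of_lt ?_ ha'a
  replace h := hg.futureTimelike_iff.2 ha'
  have h1 : g.FutureCausal t x a' v := by
    refine ⟨?_, h.1.le, h.2⟩
    rintro ⟨rfl, rfl⟩
    have := h.2
    simp [SplitMetric.val] at this
  obtain ⟨-, h2, h3⟩ := hop _ _ _ _ h1
  simp only [SplitMetric.val, gop] at h2 h3
  simp only [map_zero, zero_mul, one_mul, add_zero, zero_apply,
    smul_apply, smul_eq_mul] at h2 h3
  have h4 : Real.sqrt (α t ^ 2 * (D.h.inner x v v + (D.oneForm x v) ^ 2)) ≤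
      a' - α t * D.oneForm x v := by
    exact Real.sqrt_le_iff.2 ⟨by linarith, by nlinarith⟩
  rw [Real.sqrt_mul (sq_nonneg _), Real.sqrt_sq (hα_pos t).le] at h4
  unfold F
  linarith

end StationaryData

end Metric

/-! ### Lengths of curves and the chronological relation -/

section Curves

variable {n : ℕ} {M : Type*} [TopologicalSpace M] [ChartedSpace (EuclideanSpace ℝ (Fin n)) M]
  [IsManifold (𝓡 n) ∞ M]

namespace StationaryData

variable {D : StationaryData n M}

theorem continuousOn_speed {c : ℝ → M} {a b : ℝ}
    (hc : ∀ s ∈ Icc a b, ContMDiffAt 𝓘(ℝ, ℝ) (𝓡 n) ∞ c s) :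
    ContinuousOn (fun s => D.F (c s) (mfderiv 𝓘(ℝ, ℝ) (𝓡 n) c s (1 : ℝ))) (Icc a b) :=
  fun s hs => (D.continuousAt_F_velocity (hc s hs)).continuousWithinAt

theorem intervalIntegrable_speed {c : ℝ → M} {a b : ℝ} (hab : a ≤ b)
    (hc : ∀ s ∈ Icc a b, ContMDiffAt 𝓘(ℝ, ℝ) (𝓡 n) ∞ c s) :
    IntervalIntegrable (fun s => D.F (c s) (mfderiv 𝓘(ℝ, ℝ) (𝓡 n) c s (1 : ℝ)))
      MeasureTheory.volume a b :=
  ContinuousOn.intervalIntegrable (by rw [uIcc_of_le hab]; exact continuousOn_speed hc)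

/-- The length of a smooth curve as an interval integral. -/
theorem lintegral_speed {c : ℝ → M} {a b : ℝ} (hab : a ≤ b)
    (hc : ∀ s ∈ Icc a b, ContMDiffAt 𝓘(ℝ, ℝ) (𝓡 n) ∞ c s) :
    ∫⁻ s in Icc a b, ENNReal.ofReal (D.F (c s) (mfderiv 𝓘(ℝ, ℝ) (𝓡 n) c s (1 : ℝ))) =
      ENNReal.ofReal (∫ s in a..b, D.F (c s) (mfderiv 𝓘(ℝ, ℝ) (𝓡 n) c s (1 : ℝ))) := by
  rw [intervalIntegral.integral_of_le hab, ← MeasureTheory.integral_Icc_eq_integral_Ioc,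
    MeasureTheory.ofReal_integral_eq_lintegral_ofReal
      ((continuousOn_speed hc).integrableOn_compact isCompact_Icc)
      (Eventually.of_forall fun s => D.F_nonneg _ _)]

theorem dist_le_integral {c : ℝ → M} {a b : ℝ} (hab : a ≤ b)
    (hc : ∀ s ∈ Icc a b, ContMDiffAt 𝓘(ℝ, ℝ) (𝓡 n) ∞ c s) :
    D.dist (c a) (c b) ≤
      ENNReal.ofReal (∫ s in a..b, D.F (c s) (mfderiv 𝓘(ℝ, ℝ) (𝓡 n) c s (1 : ℝ))) := by
  refine sInf_le ?_
  have := HasCurve.cons (D := D) c a b (c b) 0 hab hc (HasCurve.nil _)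
  rwa [add_zero, lintegral_speed hab hc] at this

theorem dist_le_of_speed_le {c : ℝ → M} {a b K : ℝ} (hab : a ≤ b)
    (hc : ∀ s ∈ Icc a b, ContMDiffAt 𝓘(ℝ, ℝ) (𝓡 n) ∞ c s)
    (hF : ∀ s ∈ Icc a b, D.F (c s) (mfderiv 𝓘(ℝ, ℝ) (𝓡 n) c s (1 : ℝ)) ≤ K) :
    D.dist (c a) (c b) ≤ ENNReal.ofReal (K * (b - a)) := by
  refine (dist_le_integral hab hc).trans (ENNReal.ofReal_le_ofReal ?_)
  calc _ ≤ ∫ _ in a..b, K := intervalIntegral.integral_mono_on hab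
        (intervalIntegrable_speed hab hc) (by simp) hF
    _ = _ := by simp [mul_comm]

/-- `d⁺` is a length distance: a point at distance less than `R₁ + R₂` is reached through some
intermediate point. -/
theorem exists_between {x w : M} {R₁ R₂ : ℝ} (h₁ : 0 < R₁) (h₂ : 0 < R₂)
    (h : D.dist x w < ENNReal.ofReal (R₁ + R₂)) :
    ∃ m, D.dist x m < ENNReal.ofReal R₁ ∧ D.dist m w < ENNReal.ofReal R₂ := by
  obtain ⟨L, hL, hlt⟩ := sInf_lt_iff.1 h
  clear h
  induction hL generalizing R₁ with
  | nil x => exact ⟨x, by simpa [dist_self] using h₁, by simpa [dist_self] using h₂⟩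
  | cons c a b y L hab hc hL ih =>
    rw [lintegral_speed hab hc] at hlt
    set f : ℝ → ℝ := fun s => D.F (c s) (mfderiv 𝓘(ℝ, ℝ) (𝓡 n) c s (1 : ℝ)) with hf
    have hsub : ∀ s ∈ Icc a b, (∀ r ∈ Icc a s, ContMDiffAt 𝓘(ℝ, ℝ) (𝓡 n) ∞ c r) ∧
        ∀ r ∈ Icc s b, ContMDiffAt 𝓘(ℝ, ℝ) (𝓡 n) ∞ c r := fun s hs =>
      ⟨fun r hr => hc r ⟨hr.1, hr.2.trans hs.2⟩, fun r hr => hc r ⟨hs.1.trans hr.1, hr.2⟩⟩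
    have hnn : ∀ u v, u ≤ v → 0 ≤ ∫ s in u..v, f s := fun u v huv =>
      intervalIntegral.integral_nonneg huv fun s _ => D.F_nonneg _ _
    have hLtop : L ≠ ⊤ := by
      rintro rfl
      simp at hlt
    obtain ⟨L, rfl⟩ : ∃ l : ℝ≥0, L = l := ⟨L.toNNReal, (ENNReal.coe_toNNReal hLtop).symm⟩
    rw [← ENNReal.ofReal_coe_nnreal, ← ENNReal.ofReal_add (hnn a b hab) L.coe_nonneg,
      ENNReal.ofReal_lt_ofReal_iff (by linarith)] at hlt
    by_cases hcase : ∫ s in a..b, f s < R₁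
    · obtain ⟨m, hm1, hm2⟩ := ih (R₁ := R₁ - ∫ s in a..b, f s) (by linarith)
        (by
          rw [← ENNReal.ofReal_coe_nnreal]
          exact (ENNReal.ofReal_lt_ofReal_iff (by linarith)).2 (by linarith))
      refine ⟨m, ?_, hm2⟩
      calc D.dist (c a) m ≤ D.dist (c a) (c b) + D.dist (c b) m := D.dist_triangle _ _ _
        _ < ENNReal.ofReal (∫ s in a..b, f s) + ENNReal.ofReal (R₁ - ∫ s in a..b, f s) :=
          ENNReal.add_lt_add_of_le_of_lt
            ((dist_le_integral hab hc).trans_lt ENNReal.ofReal_lt_top).ne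
            (dist_le_integral hab hc) hm1
        _ = ENNReal.ofReal R₁ := by
          rw [← ENNReal.ofReal_add (hnn a b hab) (by linarith)]
          congr 1
          ring
    · push Not at hcase
      -- the length of the initial arc is continuous, so it takes a value just below `R₁`
      have hcont : ContinuousOn (fun s => ∫ r in a..s, f r) (Icc a b) :=
        intervalIntegral.continuousOn_primitive_interval'
          (intervalIntegrable_speed hab hc) left_mem_uIcc |>.mono (by rw [uIcc_of_le hab])
      set e := max 0 (((∫ s in a..b, f s) + L - R₂ + R₁) / 2) with he
      have he1 : e < R₁ := max_lt h₁ (by linarith)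
      have he2 : (∫ s in a..b, f s) + L - R₂ < e := lt_max_of_lt_right (by linarith)
      obtain ⟨s, hs, hse⟩ := intermediate_value_Icc hab hcont
        (show e ∈ Icc _ _ by
          simp only [intervalIntegral.integral_same]
          exact ⟨le_max_left _ _, by linarith⟩)
      refine ⟨c s, (dist_le_integral hs.1 (hsub s hs).1).trans_lt ?_, ?_⟩
      · refine (ENNReal.ofReal_lt_ofReal_iff h₁).2 ?_
        exact hse.trans_lt he1
      · have h3 : D.dist (c b) y ≤ L := sInf_le hL
        have hadd := intervalIntegral.integral_add_adjacent_intervals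
          (intervalIntegrable_speed (D := D) hs.1 (hsub s hs).1)
          (intervalIntegrable_speed (D := D) hs.2 (hsub s hs).2)
        calc D.dist (c s) y ≤ D.dist (c s) (c b) + D.dist (c b) y := D.dist_triangle _ _ _
          _ ≤ ENNReal.ofReal (∫ r in s..b, f r) + ENNReal.ofReal L :=
            add_le_add (dist_le_integral hs.2 (hsub s hs).2)
              (h3.trans_eq (ENNReal.ofReal_coe_nnreal).symm)
          _ = ENNReal.ofReal ((∫ r in s..b, f r) + L) :=
            (ENNReal.ofReal_add (hnn s b hs.2) L.coe_nonneg).symm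
          _ < ENNReal.ofReal R₂ := by
            refine (ENNReal.ofReal_lt_ofReal_iff h₂).2 ?_
            simp only [hf] at hse he2 ⊢
            linarith

end StationaryData

namespace SplitMetric

variable {D : StationaryData n M} {g : SplitMetric n M}

theorem chron_vertical (hg : g.IsSpacetime) (hcl : D.gcl.Prec g) (x : M) {t s : ℝ} (hts : t < s) :
    g.Chron (t, x) (s, x) := by
  refine Relation.TransGen.single ⟨id, fun _ => x, t, s, hts, rfl, rfl, fun r _ =>
    ⟨contDiffAt_id, contMDiffAt_const, D.futureTimelike_of_prec hg hcl ?_⟩⟩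
  rw [mfderiv_const, deriv_id]
  exact (D.F_zero x).trans_lt one_pos

/-- A smooth curve of `F⁺`-length less than `t' - t` lifts to a timelike curve between the times
`t` and `t'`: its time component is the primitive of a polynomial slightly above `F⁺(c')`. -/
theorem chron_of_integral_lt (hg : g.IsSpacetime) (hcl : D.gcl.Prec g) {c : ℝ → M} {a b : ℝ}
    (hab : a < b) (hc : ∀ s ∈ Icc a b, ContMDiffAt 𝓘(ℝ, ℝ) (𝓡 n) ∞ c s) {t t' : ℝ}
    (h : ∫ s in a..b, D.F (c s) (mfderiv 𝓘(ℝ, ℝ) (𝓡 n) c s (1 : ℝ)) < t' - t) :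
    g.Chron (t, c a) (t', c b) := by
  set f : ℝ → ℝ := fun s => D.F (c s) (mfderiv 𝓘(ℝ, ℝ) (𝓡 n) c s (1 : ℝ)) with hf
  set κ := (t' - t - ∫ s in a..b, f s) / (b - a) with hκ
  have hba : 0 < b - a := sub_pos.2 hab
  have hκpos : 0 < κ := div_pos (by linarith) hba
  have hκ' : κ * (b - a) = t' - t - ∫ s in a..b, f s := div_mul_cancel₀ _ hba.ne'
  obtain ⟨p, hp⟩ := exists_polynomial_near_of_continuousOn a b f
    (StationaryData.continuousOn_speed hc) (κ / 2) (half_pos hκpos)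
  have hpint : ∀ u v, IntervalIntegrable (fun s => p.eval s) MeasureTheory.volume u v :=
    fun u v => p.continuous.intervalIntegrable u v
  have hple : ∫ s in a..b, p.eval s ≤ (∫ s in a..b, f s) + κ / 2 * (b - a) := by
    have : ∫ s in a..b, p.eval s ≤ ∫ s in a..b, (f s + κ / 2) :=
      intervalIntegral.integral_mono_on hab.le (hpint a b)
        ((StationaryData.intervalIntegrable_speed hab.le hc).add (by simp)) fun s hs => by
          have := (abs_lt.1 (hp s hs)).2
          linarith
    rw [intervalIntegral.integral_add (StationaryData.intervalIntegrable_speed hab.le hc)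
      (by simp)] at this
    simp only [intervalIntegral.integral_const, smul_eq_mul] at this
    linarith
  set m := (t' - t - ∫ s in a..b, p.eval s) / (b - a) with hm
  have hm' : m * (b - a) = t' - t - ∫ s in a..b, p.eval s := div_mul_cancel₀ _ hba.ne'
  have hmκ : κ / 2 ≤ m := by
    refine le_of_mul_le_mul_right ?_ hba
    linarith
  have hderiv : ∀ s, HasDerivAt (fun s => t + (∫ r in a..s, p.eval r) + m * (s - a))
      (p.eval s + m) s := fun s => by
    have h1 := intervalIntegral.integral_hasDerivAt_right (hpint a s)
      (p.continuous.stronglyMeasurableAtFilter _ _) p.continuous.continuousAt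
    have h2 := ((hasDerivAt_id s).sub_const a).const_mul m
    simpa using (h1.const_add t).fun_add h2
  have hd' : deriv (fun s => t + (∫ r in a..s, p.eval r) + m * (s - a)) =
      fun s => p.eval s + m := funext fun s => (hderiv s).deriv
  have hsmooth : ContDiff ℝ ∞ (fun s => t + (∫ r in a..s, p.eval r) + m * (s - a)) := by
    rw [contDiff_infty_iff_deriv]
    refine ⟨fun s => (hderiv s).differentiableAt, ?_⟩
    rw [hd']
    exact (p.contDiff_aeval (𝕜 := ℝ) ∞ : ContDiff ℝ ∞ fun s => p.eval s).add contDiff_const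
  refine Relation.TransGen.single ⟨_, c, a, b, hab, ?_, ?_, fun s hs =>
    ⟨hsmooth.contDiffAt, hc s hs, D.futureTimelike_of_prec hg hcl ?_⟩⟩
  · simp
  · simp only [Prod.mk.injEq, and_true]
    linarith
  · rw [hd']
    have := (abs_lt.1 (hp s hs)).1
    simp only [hf] at this
    linarith

/-- Points whose time difference exceeds their `d⁺`-distance are chronologically related. -/
theorem chron_of_dist_lt (hg : g.IsSpacetime) (hcl : D.gcl.Prec g) {x y : M} {t s : ℝ}
    (h : D.dist x y < ENNReal.ofReal (s - t)) : g.Chron (t, x) (s, y) := by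
  obtain ⟨L, hL, hlt⟩ := sInf_lt_iff.1 h
  clear h
  -- the excess of time over length is split between the first smooth arc and the rest
  induction hL generalizing t with
  | nil x =>
    refine chron_vertical hg hcl x ?_
    have := ENNReal.ofReal_pos.1 (bot_le.trans_lt hlt)
    linarith
  | cons c a b y L hab hc hL ih =>
    rw [StationaryData.lintegral_speed hab hc] at hlt
    set I := ∫ s in a..b, D.F (c s) (mfderiv 𝓘(ℝ, ℝ) (𝓡 n) c s (1 : ℝ)) with hI
    have hnn : 0 ≤ I := intervalIntegral.integral_nonneg hab fun s _ => D.F_nonneg _ _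
    have hLtop : L ≠ ⊤ := by
      rintro rfl
      simp at hlt
    obtain ⟨L, rfl⟩ : ∃ l : ℝ≥0, L = l := ⟨L.toNNReal, (ENNReal.coe_toNNReal hLtop).symm⟩
    have hts : 0 < s - t := ENNReal.ofReal_pos.1 (bot_le.trans_lt hlt)
    have hL0 : (0 : ℝ) ≤ L := L.2
    rw [← ENNReal.ofReal_coe_nnreal, ← ENNReal.ofReal_add hnn L.coe_nonneg,
      ENNReal.ofReal_lt_ofReal_iff hts] at hlt
    set t₁ := t + I + (s - t - I - L) / 2 with ht₁
    have h2 : g.Chron (t₁, c b) (s, y) := ih (by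
      rw [← ENNReal.ofReal_coe_nnreal]
      exact (ENNReal.ofReal_lt_ofReal_iff (by linarith)).2 (by linarith))
    refine Relation.TransGen.trans ?_ h2
    rcases hab.eq_or_lt with rfl | hab'
    · exact chron_vertical hg hcl _ (by linarith)
    · exact chron_of_integral_lt hg hcl hab' hc (by linarith)

/-- Along `g`-timelike curves time increases, and `F⁺` is at most the speed `τ'/α(τ)` allowed by
`g_op`. -/
theorem Chron.lt_and_dist_le {α : ℝ → ℝ} (hα : Continuous α) (hα_pos : ∀ t, 0 < α t)
    (hg : g.IsSpacetime) (hop : g.Prec (D.gop α)) {p q : ℝ × M} (h : g.Chron p q) :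
    p.1 < q.1 ∧ D.dist p.2 q.2 ≤ ENNReal.ofReal (∫ s in p.1..q.1, 1 / α s) := by
  have hcont : Continuous fun s => 1 / α s := continuous_const.div hα fun s => (hα_pos s).ne'
  have hseg : ∀ {p q : ℝ × M}, g.TimelikeSegment p q →
      p.1 < q.1 ∧ D.dist p.2 q.2 ≤ ENNReal.ofReal (∫ s in p.1..q.1, 1 / α s) := by
    rintro p q ⟨τ, c, a, b, hab, rfl, rfl, hs⟩
    have hF : ∀ s ∈ Icc a b, α (τ s) * D.F (c s) (mfderiv 𝓘(ℝ, ℝ) (𝓡 n) c s (1 : ℝ)) ≤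
        deriv τ s := fun s hs' => (D.mul_F_lt_of_prec hα_pos hg hop (hs s hs').2.2).le
    have hτ' : ContinuousOn (deriv τ) (Icc a b) := fun s hs' =>
      (continuousAt_deriv_of_contDiffAt (hs s hs').1).continuousWithinAt
    have hd : ∀ s ∈ uIcc a b, HasDerivAt τ (deriv τ s) s := fun s hs' => by
      rw [uIcc_of_le hab.le] at hs'
      exact ((hs s hs').1.differentiableAt (by simp)).hasDerivAt
    have hsub : ∫ s in a..b, ((fun s => 1 / α s) ∘ τ) s * deriv τ s =
        ∫ s in τ a..τ b, 1 / α s :=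
      intervalIntegral.integral_comp_mul_deriv hd (by rwa [uIcc_of_le hab.le]) hcont
    have hpos : ∀ s ∈ Ioo a b, 0 < deriv τ s := fun s hs' =>
      lt_of_le_of_lt (mul_nonneg (hα_pos _).le (D.F_nonneg _ _))
        (D.mul_F_lt_of_prec hα_pos hg hop (hs s (Ioo_subset_Icc_self hs')).2.2)
    have hτc : ContinuousOn τ (Icc a b) := fun s hs' =>
      (hd s (by rwa [uIcc_of_le hab.le])).continuousAt.continuousWithinAt
    refine ⟨?_, ?_⟩
    · refine strictMonoOn_of_deriv_pos (convex_Icc a b) hτc ?_ (left_mem_Icc.2 hab.le)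
        (right_mem_Icc.2 hab.le) hab
      rwa [interior_Icc]
    · refine (StationaryData.dist_le_integral hab.le fun s hs' => (hs s hs').2.1).trans
        (ENNReal.ofReal_le_ofReal ?_)
      rw [← hsub]
      refine intervalIntegral.integral_mono_on hab.le
        (StationaryData.intervalIntegrable_speed hab.le fun s hs' => (hs s hs').2.1) ?_ ?_
      · refine ContinuousOn.intervalIntegrable ?_
        rw [uIcc_of_le hab.le]
        exact (hcont.comp_continuousOn hτc).mul hτ'
      · intro s hs'
        have h1 := hF s hs'
        simp only [Function.comp]
        rw [one_div, ← div_eq_inv_mul, le_div_iff₀ (hα_pos _), mul_comm]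
        exact h1
  induction h with
  | single h => exact hseg h
  | @tail q r _ h ih =>
    obtain ⟨h1, h2⟩ := hseg h
    refine ⟨ih.1.trans h1, ?_⟩
    have hi : ∀ u v, IntervalIntegrable (fun s => 1 / α s) MeasureTheory.volume u v :=
      fun u v => hcont.intervalIntegrable u v
    have hnn : ∀ u v, u ≤ v → 0 ≤ ∫ s in u..v, 1 / α s := fun u v huv =>
      intervalIntegral.integral_nonneg huv fun s _ => (one_div_pos.2 (hα_pos s)).le
    rw [← intervalIntegral.integral_add_adjacent_intervals (hi p.1 q.1) (hi q.1 r.1),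
      ENNReal.ofReal_add (hnn _ _ ih.1.le) (hnn _ _ h1.le)]
    exact (D.dist_triangle _ _ _).trans (add_le_add ih.2 h2)

/-- The end point of a timelike curve can be moved slightly into the past. -/
theorem Chron.eventually_past (hg : g.IsSpacetime) {p q : ℝ × M} (h : g.Chron p q) :
    ∀ᶠ δ in 𝓝 (0 : ℝ), g.Chron p (q.1 - δ, q.2) := by
  have hseg : ∀ {p q : ℝ × M}, g.TimelikeSegment p q →
      ∀ᶠ δ in 𝓝 (0 : ℝ), g.TimelikeSegment p (q.1 - δ, q.2) := by
    rintro p q ⟨τ, c, a, b, hab, rfl, rfl, hs⟩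
    have hba : 0 < b - a := sub_pos.2 hab
    -- being timelike is an open condition, so time may run slower by a small constant rate
    have key : ∀ᶠ κ in 𝓝 (0 : ℝ), ∀ s ∈ Icc a b, g.slope (τ s - κ * (s - a)) (c s)
        (mfderiv 𝓘(ℝ, ℝ) (𝓡 n) c s (1 : ℝ)) < deriv τ s - κ := by
      refine isCompact_Icc.eventually_forall_of_forall_eventually fun s hs' => ?_
      obtain ⟨h1, h2, h3⟩ := hs s hs'
      rw [hg.futureTimelike_iff] at h3
      have hτ : ContinuousAt τ s := h1.continuousAt
      have hτ' : ContinuousAt (deriv τ) s := continuousAt_deriv_of_contDiffAt h1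
      have hc1 : ContinuousAt (fun z : ℝ × ℝ => g.slope (τ z.2 - z.1 * (z.2 - a)) (c z.2)
          (mfderiv 𝓘(ℝ, ℝ) (𝓡 n) c z.2 (1 : ℝ))) (0, s) := by
        refine hg.continuousAt_slope (N := ℝ × ℝ) (b := fun z => c z.2)
          (v := fun z => mfderiv 𝓘(ℝ, ℝ) (𝓡 n) c z.2 (1 : ℝ)) ?_ ?_
        · exact (hτ.comp' (x := ((0 : ℝ), s)) continuousAt_snd).sub
            (by fun_prop)
        · exact (continuousAt_velocity h2).comp' (x := ((0 : ℝ), s)) continuousAt_snd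
      have hc2 : ContinuousAt (fun z : ℝ × ℝ => deriv τ z.2 - z.1) (0, s) :=
        (hτ'.comp' (x := ((0 : ℝ), s)) continuousAt_snd).sub continuousAt_fst
      exact hc1.eventually_lt hc2 (by simpa using h3)
    have hlim : Tendsto (fun δ : ℝ => δ / (b - a)) (𝓝 0) (𝓝 0) := by
      simpa using (continuous_id.div_const (b - a)).tendsto (0 : ℝ)
    filter_upwards [hlim.eventually key] with δ hδ
    refine ⟨fun s => τ s - δ / (b - a) * (s - a), c, a, b, hab, by simp, ?_, fun s hs' => ?_⟩
    · simp [hba.ne']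
    · obtain ⟨h1, h2, h3⟩ := hs s hs'
      have h4 : ContDiffAt ℝ ∞ (fun s => δ / (b - a) * (s - a)) s := by fun_prop
      refine ⟨h1.sub h4, h2, hg.futureTimelike_iff.2 ?_⟩
      have : HasDerivAt (fun s => τ s - δ / (b - a) * (s - a)) (deriv τ s - δ / (b - a)) s := by
        have h5 := ((hasDerivAt_id s).sub_const a).const_mul (δ / (b - a))
        simpa using ((h1.differentiableAt (by simp)).hasDerivAt).fun_sub h5
      rw [this.deriv]
      exact hδ s hs'
  cases h with
  | single h => exact (hseg h).mono fun δ hδ => Relation.TransGen.single hδ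
  | tail h1 h2 => exact (hseg h2).mono fun δ hδ => Relation.TransGen.tail h1 hδ

end SplitMetric

end Curves

/-! ### Local estimates and the topology of `d⁺` -/

section Local

variable {n : ℕ} {M : Type*} [TopologicalSpace M] [ChartedSpace (EuclideanSpace ℝ (Fin n)) M]
  [IsManifold (𝓡 n) ∞ M]

/-- The tangent vector at `y` with coordinates `w` in the trivialization of `TM` at `z`. -/
def tangentOfCoord (z y : M) (w : EuclideanSpace ℝ (Fin n)) : TangentSpace (𝓡 n) y :=
  (trivializationAt (EuclideanSpace ℝ (Fin n)) (TangentSpace (𝓡 n)) z).symmL ℝ y w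

theorem tangentOfCoord_smul (z y : M) (r : ℝ) (w : EuclideanSpace ℝ (Fin n)) :
    tangentOfCoord z y (r • w) = r • tangentOfCoord z y w :=
  map_smul _ _ _

theorem tangentOfCoord_zero (z y : M) :
    tangentOfCoord z y (0 : EuclideanSpace ℝ (Fin n)) = 0 :=
  map_zero _

theorem exists_tangentOfCoord_eq {z y : M}
    (hy : y ∈ (trivializationAt (EuclideanSpace ℝ (Fin n)) (TangentSpace (𝓡 n)) z).baseSet)
    (v : TangentSpace (𝓡 n) y) : ∃ w : EuclideanSpace ℝ (Fin n), tangentOfCoord z y w = v :=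
  ⟨_, Bundle.Trivialization.symmL_continuousLinearMapAt (R := ℝ) _ hy v⟩

theorem tangentOfCoord_self_ne_zero (z : M) {w : EuclideanSpace ℝ (Fin n)} (hw : w ≠ 0) :
    tangentOfCoord z z w ≠ 0 := fun h => hw <| by
  have h1 := Bundle.Trivialization.continuousLinearMapAt_symmL (R := ℝ)
    (trivializationAt (EuclideanSpace ℝ (Fin n)) (TangentSpace (𝓡 n)) z)
    (FiberBundle.mem_baseSet_trivializationAt' z) w
  have h2 : (trivializationAt (EuclideanSpace ℝ (Fin n)) (TangentSpace (𝓡 n)) z).symmL ℝ z w = 0 :=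
    h
  rw [← h1, h2, map_zero]

theorem contMDiffAt_tangentOfCoord (z : M) (w : EuclideanSpace ℝ (Fin n)) :
    ContMDiffAt ((𝓡 n).prod 𝓘(ℝ, EuclideanSpace ℝ (Fin n)))
      ((𝓡 n).prod 𝓘(ℝ, EuclideanSpace ℝ (Fin n))) 1
      (fun q : M × EuclideanSpace ℝ (Fin n) =>
        (⟨q.1, tangentOfCoord z q.1 q.2⟩ : TangentBundle (𝓡 n) M)) (z, w) := by
  set e := trivializationAt (EuclideanSpace ℝ (Fin n)) (TangentSpace (𝓡 n)) z with he
  have hz : z ∈ e.baseSet := FiberBundle.mem_baseSet_trivializationAt' z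
  have h1 := (e.contMDiffOn_symm (IB := 𝓡 n) (n := 1)).contMDiffAt
    (e.open_target.mem_nhds (e.mem_target.2 (show (z, w).1 ∈ _ from hz)))
  refine h1.congr_of_eventuallyEq ?_
  filter_upwards [(e.open_baseSet.preimage continuous_fst).mem_nhds (show (z, w).1 ∈ _ from hz)]
    with q hq
  rw [← e.mk_symm hq]
  simp only [tangentOfCoord]
  rw [e.symmL_apply hq]

theorem continuousAt_tangentOfCoord (z : M) (w : EuclideanSpace ℝ (Fin n)) :
    ContinuousAt (fun q : M × EuclideanSpace ℝ (Fin n) =>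
        (⟨q.1, tangentOfCoord z q.1 q.2⟩ : TangentBundle (𝓡 n) M)) (z, w) :=
  (contMDiffAt_tangentOfCoord z w).continuousAt

/-- A positively homogeneous property of tangent vectors that depends monotonically on a constant
holds locally with a uniform constant as soon as it does near each nonzero vector over the base
point. This is the compactness of the unit sphere. -/
theorem exists_eventually_forall_tangent {X : Type*} [TopologicalSpace X] {b : X → M} {x₀ : X}
    (hb : ContinuousAt b x₀) (P : ℝ → (x : X) → TangentSpace (𝓡 n) (b x) → Prop)
    (mono : ∀ K K' x v, K ≤ K' → P K x v → P K' x v)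
    (homog : ∀ K x v (r : ℝ), 0 ≤ r → P K x v → P K x (r • v))
    (zero : ∀ K x, P K x 0)
    (h : ∀ w : EuclideanSpace ℝ (Fin n), w ≠ 0 → ∃ K, ∀ᶠ q : X × EuclideanSpace ℝ (Fin n) in
      𝓝 (x₀, w), P K q.1 (tangentOfCoord (b x₀) (b q.1) q.2)) :
    ∃ K, ∀ᶠ x in 𝓝 x₀, ∀ v, P K x v := by
  have key : ∃ K, ∀ᶠ x in 𝓝 x₀, ∀ w ∈ Metric.sphere (0 : EuclideanSpace ℝ (Fin n)) 1,
      P K x (tangentOfCoord (b x₀) (b x) w) := by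
    refine IsCompact.induction_on (isCompact_sphere (0 : EuclideanSpace ℝ (Fin n)) 1)
      (p := fun S => ∃ K, ∀ᶠ x in 𝓝 x₀, ∀ w ∈ S, P K x (tangentOfCoord (b x₀) (b x) w))
      ⟨0, by simp⟩ ?_ ?_ ?_
    · rintro s t hst ⟨K, hK⟩
      exact ⟨K, hK.mono fun x hx w hw => hx w (hst hw)⟩
    · rintro s t ⟨K, hK⟩ ⟨K', hK'⟩
      refine ⟨max K K', ?_⟩
      filter_upwards [hK, hK'] with x hx hx' w hw
      rcases hw with hw | hw
      · exact mono _ _ _ _ (le_max_left _ _) (hx w hw)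
      · exact mono _ _ _ _ (le_max_right _ _) (hx' w hw)
    · intro w hw
      obtain ⟨K, hK⟩ := h w (by rintro rfl; simp at hw)
      rw [nhds_prod_eq] at hK
      obtain ⟨pa, hpa, pb, hpb, hp⟩ := eventually_prod_iff.1 hK
      exact ⟨{w | pb w}, mem_nhdsWithin_of_mem_nhds hpb, K, hpa.mono fun x hx w hw => hp hx hw⟩
  obtain ⟨K, hK⟩ := key
  refine ⟨K, ?_⟩
  have hbase : ∀ᶠ x in 𝓝 x₀, b x ∈
      (trivializationAt (EuclideanSpace ℝ (Fin n)) (TangentSpace (𝓡 n)) (b x₀)).baseSet :=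
    hb.eventually ((trivializationAt (EuclideanSpace ℝ (Fin n)) (TangentSpace (𝓡 n))
      (b x₀)).open_baseSet.mem_nhds (FiberBundle.mem_baseSet_trivializationAt' (b x₀)))
  filter_upwards [hK, hbase] with x hx hbx v
  obtain ⟨w, rfl⟩ := exists_tangentOfCoord_eq hbx v
  by_cases hw : w = 0
  · rw [hw, tangentOfCoord_zero]
    exact zero K x
  · have h1 : ‖w‖⁻¹ • w ∈ Metric.sphere (0 : EuclideanSpace ℝ (Fin n)) 1 := by
      simp [norm_smul, hw]
    have h2 := homog K x _ ‖w‖ (norm_nonneg w) (hx _ h1)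
    rwa [← tangentOfCoord_smul, smul_smul, mul_inv_cancel₀ (norm_ne_zero_iff.2 hw), one_smul] at h2

theorem StationaryData.mul_F_le_slope (D : StationaryData n M) {α : ℝ → ℝ}
    (hα_pos : ∀ t, 0 < α t) {g : SplitMetric n M} (hg : g.IsSpacetime) (hop : g.Prec (D.gop α))
    (t : ℝ) (x : M) (v : TangentSpace (𝓡 n) x) : α t * D.F x v ≤ g.slope t x v :=
  le_of_forall_gt fun _ ha => D.mul_F_lt_of_prec hα_pos hg hop (hg.futureTimelike_iff.2 ha)

/-- The slope is Lipschitz in time, locally uniformly and relative to its size: near a nonzero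
vector it is smooth and bounded below, and it is positively homogeneous in the vector. -/
theorem SplitMetric.IsSpacetime.exists_slope_le {D : StationaryData n M} {α : ℝ → ℝ}
    (hα_pos : ∀ t, 0 < α t) {g : SplitMetric n M} (hg : g.IsSpacetime) (hop : g.Prec (D.gop α))
    (t₀ : ℝ) (z : M) :
    ∃ K, ∀ᶠ q : ℝ × ℝ × M in 𝓝 (t₀, t₀, z), ∀ v : TangentSpace (𝓡 n) q.2.2,
      g.slope q.2.1 q.2.2 v ≤ (1 + K * |q.1 - q.2.1|) * g.slope q.1 q.2.2 v := by
  have hnn : ∀ t x v, 0 ≤ g.slope t x v := fun t x v =>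
    (mul_nonneg (hα_pos t).le (D.F_nonneg x v)).trans (D.mul_F_le_slope hα_pos hg hop t x v)
  refine exists_eventually_forall_tangent (b := fun q : ℝ × ℝ × M => q.2.2) (x₀ := (t₀, t₀, z))
    (by fun_prop) (fun K q v => g.slope q.2.1 q.2.2 v ≤
      (1 + K * |q.1 - q.2.1|) * g.slope q.1 q.2.2 v) ?_ ?_ ?_ ?_
  · intro K K' q v hK h
    refine h.trans (mul_le_mul_of_nonneg_right ?_ (hnn _ _ _))
    gcongr
  · intro K q v r hr h
    rw [SplitMetric.slope_smul _ _ _ _ hr, SplitMetric.slope_smul _ _ _ _ hr]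
    nlinarith
  · intro K q
    simp
  intro w hw
  set φ := extChartAt (𝓡 n) z with hφ
  set S : ℝ × M × EuclideanSpace ℝ (Fin n) → ℝ :=
    fun q => g.slope q.1 q.2.1 (tangentOfCoord z q.2.1 q.2.2) with hS
  have hpos : 0 < S (t₀, z, w) :=
    (mul_pos (hα_pos _) (D.F_pos z (tangentOfCoord_self_ne_zero z hw))).trans_le
      (D.mul_F_le_slope hα_pos hg hop _ _ _)
  have hSc : ContinuousAt S (t₀, z, w) := by
    refine hg.continuousAt_slope (b := fun q : ℝ × M × EuclideanSpace ℝ (Fin n) => q.2.1)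
      (v := fun q => tangentOfCoord z q.2.1 q.2.2) continuousAt_fst ?_
    exact (continuousAt_tangentOfCoord z w).comp' (x := (t₀, z, w)) continuousAt_snd
  have hsymm : ContMDiffAt 𝓘(ℝ, EuclideanSpace ℝ (Fin n)) (𝓡 n) 1 φ.symm (φ z) :=
    ((contMDiffOn_extChartAt_symm z).contMDiffAt (extChartAt_target_mem_nhds z))
  have hφz : φ.symm (φ z) = z := extChartAt_to_inv z
  have hsmooth : ContDiffAt ℝ 1 (fun q : ℝ × EuclideanSpace ℝ (Fin n) × EuclideanSpace ℝ (Fin n) =>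
      S (q.1, φ.symm q.2.1, q.2.2)) (t₀, φ z, w) := by
    rw [← contMDiffAt_iff_contDiffAt]
    refine hg.contMDiffAt_slope
      (b := fun q : ℝ × EuclideanSpace ℝ (Fin n) × EuclideanSpace ℝ (Fin n) => φ.symm q.2.1)
      (v := fun q => tangentOfCoord z (φ.symm q.2.1) q.2.2) (by exact_mod_cast le_top)
      contDiffAt_fst.contMDiffAt ?_ ?_
    · have h1 : ContMDiffAt 𝓘(ℝ, ℝ × EuclideanSpace ℝ (Fin n) × EuclideanSpace ℝ (Fin n))
          ((𝓡 n).prod 𝓘(ℝ, EuclideanSpace ℝ (Fin n))) 1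
          (fun q : ℝ × EuclideanSpace ℝ (Fin n) × EuclideanSpace ℝ (Fin n) =>
            (φ.symm q.2.1, q.2.2)) (t₀, φ z, w) := by
        refine ContMDiffAt.prodMk ?_ ?_
        · exact ContMDiffAt.comp (t₀, φ z, w) (g := φ.symm) hsymm
            (contDiffAt_fst.comp _ contDiffAt_snd).contMDiffAt
        · exact (contDiffAt_snd.comp _ contDiffAt_snd).contMDiffAt
      exact ContMDiffAt.comp (t₀, φ z, w) (by rw [hφz]; exact contMDiffAt_tangentOfCoord z w) h1
    · change tangentOfCoord z (φ.symm (φ z)) w ≠ 0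
      rw [hφz]
      exact tangentOfCoord_self_ne_zero z hw
  obtain ⟨L, T, hT, hL⟩ := hsmooth.exists_lipschitzOnWith
  refine ⟨L / (S (t₀, z, w) / 2), ?_⟩
  have hφc : ContinuousAt φ z := continuousAt_extChartAt z
  have hc1 : ContinuousAt (fun q : (ℝ × ℝ × M) × EuclideanSpace ℝ (Fin n) =>
      (q.1.1, φ q.1.2.2, q.2)) ((t₀, t₀, z), w) :=
    ContinuousAt.prodMk (by fun_prop) (ContinuousAt.prodMk
      (hφc.comp' (x := ((t₀, t₀, z), w)) (by fun_prop)) (by fun_prop))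
  have hc2 : ContinuousAt (fun q : (ℝ × ℝ × M) × EuclideanSpace ℝ (Fin n) =>
      (q.1.2.1, φ q.1.2.2, q.2)) ((t₀, t₀, z), w) :=
    ContinuousAt.prodMk (by fun_prop) (ContinuousAt.prodMk
      (hφc.comp' (x := ((t₀, t₀, z), w)) (by fun_prop)) (by fun_prop))
  have hc3 : ContinuousAt (fun q : (ℝ × ℝ × M) × EuclideanSpace ℝ (Fin n) =>
      (q.1.1, q.1.2.2, q.2)) ((t₀, t₀, z), w) := by fun_prop
  have hc4 : ContinuousAt (fun q : (ℝ × ℝ × M) × EuclideanSpace ℝ (Fin n) => q.1.2.2)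
    ((t₀, t₀, z), w) := by fun_prop
  filter_upwards [hc1.eventually hT, hc2.eventually hT,
    (ContinuousAt.comp (x := ((t₀, t₀, z), w)) hSc hc3).eventually
      (lt_mem_nhds (half_lt_self hpos)),
    hc4.eventually (extChartAt_source_mem_nhds (I := 𝓡 n) z)] with q h1 h2 h3 h4
  have h5 := hL.dist_le_mul _ h2 _ h1
  simp only [← hφ] at h4
  simp only [φ.left_inv h4] at h5
  have h6 : dist (q.1.2.1, φ q.1.2.2, q.2) (q.1.1, φ q.1.2.2, q.2) = |q.1.1 - q.1.2.1| := by
    simp [Prod.dist_eq, Real.dist_eq, abs_sub_comm]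
  rw [h6, Real.dist_eq] at h5
  have h7 := (abs_le.1 h5).2
  simp only [hS, Function.comp] at h3 h5 h7 hpos ⊢
  have h8 : (L : ℝ) * |q.1.1 - q.1.2.1| ≤
      L / (g.slope t₀ z (tangentOfCoord z z w) / 2) * |q.1.1 - q.1.2.1| *
        g.slope q.1.1 q.1.2.2 (tangentOfCoord z q.1.2.2 q.2) := by
    rw [div_mul_eq_mul_div, div_mul_eq_mul_div, le_div_iff₀ (half_pos hpos)]
    exact mul_le_mul_of_nonneg_left h3.le (by positivity)
  linarith

/-- The differential of a real function, with values in `ℝ` rather than in a tangent space of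
`ℝ`. -/
def differential (ψ : M → ℝ) (y : M) : TangentSpace (𝓡 n) y →L[ℝ] ℝ :=
  mfderiv (𝓡 n) 𝓘(ℝ, ℝ) ψ y

namespace StationaryData

variable (D : StationaryData n M)

/-- Points that are close in the manifold topology are `d⁺`-close, in both directions: the
segments in a chart are short. -/
theorem eventually_dist_lt (x : M) {ε : ℝ} (hε : 0 < ε) :
    ∀ᶠ y in 𝓝 x, D.dist x y < ENNReal.ofReal ε ∧ D.dist y x < ENNReal.ofReal ε := by
  set φ := extChartAt (𝓡 n) x with hφ
  have hF : ContinuousAt (fun q : M × EuclideanSpace ℝ (Fin n) =>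
      D.F q.1 (tangentOfCoord x q.1 q.2)) (x, 0) :=
    D.continuousAt_F (b := fun q : M × EuclideanSpace ℝ (Fin n) => q.1)
      (v := fun q => tangentOfCoord x q.1 q.2) (continuousAt_tangentOfCoord x 0)
  have h1 : ∀ᶠ q in 𝓝 (x, (0 : EuclideanSpace ℝ (Fin n))),
      D.F q.1 (tangentOfCoord x q.1 q.2) < ε / 2 :=
    hF.eventually (gt_mem_nhds (by simpa [tangentOfCoord_zero, F_zero] using half_pos hε))
  rw [nhds_prod_eq] at h1
  obtain ⟨pa, hpa, pb, hpb, hp⟩ := eventually_prod_iff.1 h1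
  obtain ⟨r', hr', hpb'⟩ := Metric.eventually_nhds_iff_ball.1 hpb
  have hsymm : ContinuousAt φ.symm (φ x) := continuousAt_extChartAt_symm x
  have hpa' : ∀ᶠ u in 𝓝 (φ x), pa (φ.symm u) := by
    refine hsymm.eventually ?_
    rwa [hφ, extChartAt_to_inv]
  obtain ⟨r, hr, hball⟩ := Metric.eventually_nhds_iff_ball.1
    (hpa'.and (extChartAt_target_mem_nhds (I := 𝓡 n) x))
  -- the estimate for a segment inside the ball of radius `r` of the chart
  have key : ∀ u ∈ Metric.ball (φ x) r, ∀ u' ∈ Metric.ball (φ x) r, ‖u' - u‖ < r' →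
      D.dist (φ.symm u) (φ.symm u') < ENNReal.ofReal ε := by
    intro u hu u' hu' huu'
    set ℓ : ℝ → EuclideanSpace ℝ (Fin n) := fun s => u + s • (u' - u) with hℓ
    have hℓd : ∀ s, HasDerivAt ℓ (u' - u) s := fun s => by
      have := ((hasDerivAt_id' s).smul_const (u' - u)).const_add u
      rwa [one_smul] at this
    have hmem : ∀ s ∈ Icc (0 : ℝ) 1, ℓ s ∈ Metric.ball (φ x) r := fun s hs => by
      have : ℓ s = (1 - s) • u + s • u' := by simp only [hℓ]; module
      rw [this]
      exact convex_ball (φ x) r hu hu' (by linarith [hs.2]) hs.1 (by ring)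
    have hc : ∀ s ∈ Icc (0 : ℝ) 1, ContMDiffAt 𝓘(ℝ, ℝ) (𝓡 n) ∞ (fun s => φ.symm (ℓ s)) s :=
      fun s hs => ((contMDiffOn_extChartAt_symm x).contMDiffAt
        ((isOpen_extChartAt_target x).mem_nhds (hball _ (hmem s hs)).2)).comp s
        (by simp only [hℓ]; exact (by fun_prop : ContDiffAt ℝ ∞ _ s).contMDiffAt)
    have hspeed : ∀ s ∈ Icc (0 : ℝ) 1,
        D.F (φ.symm (ℓ s)) (mfderiv 𝓘(ℝ, ℝ) (𝓡 n) (fun s => φ.symm (ℓ s)) s (1 : ℝ)) ≤ ε / 2 := by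
      intro s hs
      have ht := (hball _ (hmem s hs)).2
      have hv : mfderiv 𝓘(ℝ, ℝ) (𝓡 n) (fun s => φ.symm (ℓ s)) s (1 : ℝ) =
          tangentOfCoord x (φ.symm (ℓ s)) (u' - u) := by
        have hd : MDifferentiableAt 𝓘(ℝ, EuclideanSpace ℝ (Fin n)) (𝓡 n) φ.symm (ℓ s) :=
          ((contMDiffOn_extChartAt_symm (n := 1) x).contMDiffAt
            ((isOpen_extChartAt_target x).mem_nhds ht)).mdifferentiableAt (by simp)
        have h2 := mfderiv_comp s hd (hℓd s).differentiableAt.mdifferentiableAt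
        have h3 := TangentBundle.symmL_trivializationAt (I := 𝓡 n) (𝕜 := ℝ) (x₀ := x)
          (x := φ.symm (ℓ s)) (by
            rw [← extChartAt_source (𝓡 n)]
            exact φ.map_target ht)
        have h4 : φ (φ.symm (ℓ s)) = ℓ s := φ.right_inv ht
        rw [ModelWithCorners.range_eq_univ, mfderivWithin_univ, ← hφ, h4] at h3
        have h6 : mfderiv 𝓘(ℝ, ℝ) 𝓘(ℝ, EuclideanSpace ℝ (Fin n)) ℓ s (1 : ℝ) = u' - u := by
          have := (hℓd s).deriv
          rwa [← fderiv_apply_one_eq_deriv, ← mfderiv_eq_fderiv] at this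
        exact (DFunLike.congr_fun h2 (1 : ℝ)).trans ((congrArg (mfderiv
          𝓘(ℝ, EuclideanSpace ℝ (Fin n)) (𝓡 n) φ.symm (ℓ s)) h6).trans
          (DFunLike.congr_fun h3 (u' - u)).symm)
      rw [hv]
      exact (hp (hball _ (hmem s hs)).1 (hpb' (u' - u) (by simpa using huu'))).le
    have := dist_le_of_speed_le zero_le_one hc hspeed
    simp only [hℓ] at this
    refine lt_of_le_of_lt (by simpa using this) ((ENNReal.ofReal_lt_ofReal_iff hε).2 ?_)
    linarith
  have hφc : ContinuousAt φ x := continuousAt_extChartAt x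
  filter_upwards [hφc.eventually (Metric.ball_mem_nhds _ hr),
    hφc.eventually (Metric.ball_mem_nhds _ hr'), extChartAt_source_mem_nhds (I := 𝓡 n) x]
    with y h1 h2 h3
  have hxy : φ.symm (φ y) = y := φ.left_inv h3
  have hxx : φ.symm (φ x) = x := extChartAt_to_inv x
  rw [dist_eq_norm] at h2
  refine ⟨?_, ?_⟩
  · have := key (φ x) (Metric.mem_ball_self hr) (φ y) h1 h2
    rwa [hxy, hxx] at this
  · have := key (φ y) h1 (φ x) (Metric.mem_ball_self hr) (by rwa [norm_sub_rev])
    rwa [hxy, hxx] at this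

theorem dist_lt_top [ConnectedSpace M] (x y : M) : D.dist x y < ⊤ := by
  have hclopen : IsClopen {y | D.dist x y < ⊤} := by
    constructor
    · refine isOpen_compl_iff.1 (isOpen_iff_mem_nhds.2 fun y hy => ?_)
      filter_upwards [D.eventually_dist_lt y one_pos] with z hz hxz
      refine hy ((D.dist_triangle x z y).trans_lt ?_)
      exact ENNReal.add_lt_top.2 ⟨hxz, hz.2.trans ENNReal.ofReal_lt_top⟩
    · refine isOpen_iff_mem_nhds.2 fun y hy => ?_
      filter_upwards [D.eventually_dist_lt y one_pos] with z hz
      refine (D.dist_triangle x y z).trans_lt ?_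
      exact ENNReal.add_lt_top.2 ⟨hy, hz.1.trans ENNReal.ofReal_lt_top⟩
  have := hclopen.eq_univ ⟨x, by simp [dist_self]⟩
  exact (this ▸ mem_univ y : y ∈ {y | D.dist x y < ⊤})

/-- A smooth function with compact support is Lipschitz for `d⁺`. -/
theorem exists_differential_le_mul_F {ψ : M → ℝ} (hψ : ContMDiff (𝓡 n) 𝓘(ℝ, ℝ) ∞ ψ)
    (hsupp : HasCompactSupport ψ) :
    ∃ K : ℝ≥0, ∀ (y : M) (v : TangentSpace (𝓡 n) y),
      |differential ψ y v| ≤ K * D.F y v := by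
  have hloc : ∀ y₀ : M, ∃ K : ℝ, ∀ᶠ y in 𝓝 y₀, ∀ v : TangentSpace (𝓡 n) y,
      |differential ψ y v| ≤ K * D.F y v := by
    intro y₀
    refine exists_eventually_forall_tangent (b := fun y : M => y) continuousAt_id
      (fun K y v => |differential ψ y v| ≤ K * D.F y v) ?_ ?_ ?_ ?_
    · intro K K' y v hK h
      exact h.trans (mul_le_mul_of_nonneg_right hK (D.F_nonneg _ _))
    · intro K y v r hr h
      rw [D.F_smul _ _ hr, map_smul]
      rw [smul_eq_mul, abs_mul, abs_of_nonneg hr]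
      nlinarith
    · intro K y
      simp [F_zero]
    · intro w hw
      have hFc : ContinuousAt (fun q : M × EuclideanSpace ℝ (Fin n) =>
          D.F q.1 (tangentOfCoord y₀ q.1 q.2)) (y₀, w) :=
        D.continuousAt_F (b := fun q : M × EuclideanSpace ℝ (Fin n) => q.1)
          (v := fun q => tangentOfCoord y₀ q.1 q.2) (continuousAt_tangentOfCoord y₀ w)
      have hpos := D.F_pos y₀ (tangentOfCoord_self_ne_zero y₀ hw)
      have hdc : ContinuousAt (fun q : M × EuclideanSpace ℝ (Fin n) =>
          differential ψ q.1 (tangentOfCoord y₀ q.1 q.2)) (y₀, w) := by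
        have h1 : Continuous fun p : TangentBundle (𝓡 n) M =>
            (tangentMap (𝓡 n) 𝓘(ℝ, ℝ) ψ p).2 :=
          (contMDiff_snd_tangentBundle_modelSpace (n := 0) ℝ 𝓘(ℝ, ℝ)).continuous.comp
            (hψ.continuous_tangentMap (by simp))
        exact h1.continuousAt.comp (continuousAt_tangentOfCoord y₀ w)
      set A : ℝ := |differential ψ y₀ (tangentOfCoord y₀ y₀ w)| with hA
      refine ⟨(A + 1) / D.F y₀ (tangentOfCoord y₀ y₀ w), ?_⟩
      refine (hdc.abs.eventually_lt (continuousAt_const.mul hFc) ?_).mono fun q hq => hq.le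
      change _ < (A + 1) / D.F y₀ (tangentOfCoord y₀ y₀ w) * D.F y₀ (tangentOfCoord y₀ y₀ w)
      rw [div_mul_cancel₀ _ hpos.ne']
      linarith
  have hcomp : ∃ K : ℝ, ∀ y ∈ tsupport ψ, ∀ v : TangentSpace (𝓡 n) y,
      |differential ψ y v| ≤ K * D.F y v := by
    refine IsCompact.induction_on (p := fun S => ∃ K : ℝ, ∀ y ∈ S, ∀ v : TangentSpace (𝓡 n) y,
      |differential ψ y v| ≤ K * D.F y v) hsupp ⟨0, by simp⟩ ?_ ?_ ?_
    · rintro s t hst ⟨K, hK⟩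
      exact ⟨K, fun y hy => hK y (hst hy)⟩
    · rintro s t ⟨K, hK⟩ ⟨K', hK'⟩
      refine ⟨max K K', fun y hy v => ?_⟩
      rcases hy with hy | hy
      · exact (hK y hy v).trans (mul_le_mul_of_nonneg_right (le_max_left _ _) (D.F_nonneg _ _))
      · exact (hK' y hy v).trans (mul_le_mul_of_nonneg_right (le_max_right _ _) (D.F_nonneg _ _))
    · intro y _
      obtain ⟨K, hK⟩ := hloc y
      exact ⟨_, mem_nhdsWithin_of_mem_nhds hK, K, fun y hy => hy⟩
  obtain ⟨K, hK⟩ := hcomp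
  refine ⟨K.toNNReal, fun y v => ?_⟩
  by_cases hy : y ∈ tsupport ψ
  · exact (hK y hy v).trans
      (mul_le_mul_of_nonneg_right (Real.le_coe_toNNReal K) (D.F_nonneg _ _))
  · have h1 : ψ =ᶠ[𝓝 y] fun _ => 0 := notMem_tsupport_iff_eventuallyEq.1 hy
    have h2 : differential (n := n) ψ y = 0 := by
      unfold differential
      rw [h1.mfderiv_eq, mfderiv_const]
      rfl
    rw [h2, zero_apply, abs_zero]
    exact mul_nonneg K.toNNReal.coe_nonneg (D.F_nonneg y v)

theorem HasCurve.enorm_sub_le {D : StationaryData n M} {ψ : M → ℝ}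
    (hψ : ContMDiff (𝓡 n) 𝓘(ℝ, ℝ) ∞ ψ) {K : ℝ≥0}
    (hK : ∀ (y : M) (v : TangentSpace (𝓡 n) y),
      |differential ψ y v| ≤ K * D.F y v) {x y : M} {L : ℝ≥0∞}
    (h : D.HasCurve x y L) : ‖ψ y - ψ x‖ₑ ≤ K * L := by
  induction h with
  | nil x => simp
  | cons c a b y L hab hc _ ih =>
    have hd : ∀ s ∈ Icc a b, ContDiffAt ℝ ∞ (fun s => ψ (c s)) s := fun s hs =>
      (hψ.contMDiffAt.comp s (hc s hs)).contDiffAt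
    have h1 : ‖ψ (c b) - ψ (c a)‖ₑ ≤ ∫⁻ s in Icc a b, ‖deriv (fun s => ψ (c s)) s‖ₑ :=
      enorm_sub_le_lintegral_deriv_of_contDiffOn_Icc (f := fun s => ψ (c s))
        (fun s hs => ((hd s hs).of_le (by exact_mod_cast le_top)).contDiffWithinAt) hab
    have h2 : ∫⁻ s in Icc a b, ‖deriv (fun s => ψ (c s)) s‖ₑ ≤ ∫⁻ s in Icc a b,
        K * ENNReal.ofReal (D.F (c s) (mfderiv 𝓘(ℝ, ℝ) (𝓡 n) c s (1 : ℝ))) := by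
      refine MeasureTheory.setLIntegral_mono' measurableSet_Icc fun s hs => ?_
      have h3 : deriv (fun s => ψ (c s)) s =
          differential ψ (c s) (mfderiv 𝓘(ℝ, ℝ) (𝓡 n) c s (1 : ℝ)) := by
        have h4 := mfderiv_comp s (hψ.mdifferentiableAt (x := c s) (by simp))
          ((hc s hs).mdifferentiableAt (by simp))
        rw [← fderiv_apply_one_eq_deriv, ← mfderiv_eq_fderiv]
        exact DFunLike.congr_fun h4 (1 : ℝ)
      rw [h3, ← ENNReal.ofReal_coe_nnreal,
        ← ENNReal.ofReal_mul K.coe_nonneg, Real.enorm_eq_ofReal_abs]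
      exact ENNReal.ofReal_le_ofReal (hK _ _)
    rw [MeasureTheory.lintegral_const_mul' _ _ ENNReal.coe_ne_top] at h2
    rw [mul_add]
    calc ‖ψ y - ψ (c a)‖ₑ = ‖(ψ (c b) - ψ (c a)) + (ψ y - ψ (c b))‖ₑ := by congr 1; ring
      _ ≤ ‖ψ (c b) - ψ (c a)‖ₑ + ‖ψ y - ψ (c b)‖ₑ := enorm_add_le _ _
      _ ≤ _ := add_le_add (h1.trans h2) ih

/-- Forward balls are small in the manifold topology: a bump function around the centre is
Lipschitz for `d⁺`. -/
theorem exists_ball_subset [T2Space M] {x : M} {U : Set M} (hU : U ∈ 𝓝 x) :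
    ∃ η : ℝ, 0 < η ∧ ∀ y, D.dist x y < ENNReal.ofReal η → y ∈ U := by
  obtain ⟨ψ, -, hψU⟩ := (SmoothBumpFunction.nhds_basis_tsupport (I := 𝓡 n) x).mem_iff.1 hU
  obtain ⟨K, hK⟩ := D.exists_differential_le_mul_F ψ.contMDiff ψ.hasCompactSupport
  refine ⟨1 / (K + 1), by positivity, fun y hy => ?_⟩
  by_contra hyU
  have h0 : ψ y = 0 := image_eq_zero_of_notMem_tsupport fun h => hyU (hψU h)
  have h1 : ψ x = 1 := ψ.eq_one
  obtain ⟨L, hL, hlt⟩ := sInf_lt_iff.1 hy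
  have h2 := hL.enorm_sub_le ψ.contMDiff hK
  rw [h0, h1] at h2
  have h3 : (1 : ℝ≥0∞) ≤ K * L := by simpa using h2
  have h4 : (K : ℝ≥0∞) * L ≤ K * ENNReal.ofReal (1 / (K + 1)) := by gcongr
  have h5 : (K : ℝ≥0∞) * ENNReal.ofReal (1 / (K + 1)) < 1 := by
    rw [← ENNReal.ofReal_coe_nnreal, ← ENNReal.ofReal_mul K.coe_nonneg, ENNReal.ofReal_lt_one]
    have := K.coe_nonneg
    rw [mul_one_div, div_lt_one (by linarith)]
    linarith
  exact absurd (h3.trans h4) (not_le.2 h5)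

end StationaryData

end Local

/-! ### Past sets -/

section PastSets

variable {n : ℕ} {M : Type*} [TopologicalSpace M] [ChartedSpace (EuclideanSpace ℝ (Fin n)) M]

namespace SplitMetric

variable {g : SplitMetric n M}

theorem past_mono {S S' : Set (ℝ × M)} (h : S ⊆ S') : g.past S ⊆ g.past S' :=
  fun _ ⟨q, hq, hpq⟩ => ⟨q, h hq, hpq⟩

theorem past_past_subset (S : Set (ℝ × M)) : g.past (g.past S) ⊆ g.past S :=
  fun _ ⟨_, ⟨r, hr, hqr⟩, hpq⟩ => ⟨r, hr, hpq.trans hqr⟩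

/-- A past set in which any two events have a common chronological successor is indecomposable. -/
theorem isIP_of_directed {P : Set (ℝ × M)} (hP : g.IsPastSet P)
    (hdir : ∀ p ∈ P, ∀ q ∈ P, ∃ r ∈ P, g.Chron p r ∧ g.Chron q r) : g.IsIP P := by
  refine ⟨hP, fun A B hA hB hAB => ?_⟩
  by_contra! hne
  obtain ⟨p, hp, hpA⟩ := not_subset.1 fun h =>
    hne.1 (Subset.antisymm (hAB ▸ subset_union_left) h)
  obtain ⟨q, hq, hqB⟩ := not_subset.1 fun h =>
    hne.2 (Subset.antisymm (hAB ▸ subset_union_right) h)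
  obtain ⟨r, hr, hpr, hqr⟩ := hdir p hp q hq
  rw [hAB] at hr
  rcases hr with hr | hr
  · exact hpA (hA.2 ▸ ⟨r, hr, hpr⟩)
  · exact hqB (hB.2 ▸ ⟨r, hr, hqr⟩)

variable [IsManifold (𝓡 n) ∞ M] {D : StationaryData n M}

/-- Pasts are past sets, since the end point of a timelike curve can be moved into the past. -/
theorem past_past_eq (hg : g.IsSpacetime) (hcl : D.gcl.Prec g) (S : Set (ℝ × M)) :
    g.past (g.past S) = g.past S := by
  refine (past_past_subset S).antisymm ?_
  rintro p ⟨q, hq, hpq⟩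
  obtain ⟨δ, hδ, hδ0⟩ := ((hpq.eventually_past hg).filter_mono nhdsWithin_le_nhds |>.and
    (self_mem_nhdsWithin : Ioi (0 : ℝ) ∈ 𝓝[>] 0)).exists
  exact ⟨_, ⟨q, hq, chron_vertical hg hcl q.2 (sub_lt_self _ hδ0)⟩, hδ⟩

theorem pastOf_subset_past (hg : g.IsSpacetime) (hcl : D.gcl.Prec g) (f : M → ℝ) :
    pastOf f ⊆ g.past (pastOf f) := fun p hp => by
  obtain ⟨s, h1, h2⟩ := exists_between (show p.1 < f p.2 from hp)
  exact ⟨(s, p.2), h2, chron_vertical hg hcl p.2 h1⟩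

/-- A set `P_cl(f)` that is directed for the chronological relation of `g_cl` has an indecomposable
past for `g`. -/
theorem isIP_past_pastOf [Nonempty M] (hg : g.IsSpacetime) (hcl : D.gcl.Prec g) {f : M → ℝ}
    (hdir : ∀ p ∈ pastOf f, ∀ q ∈ pastOf f, ∃ r ∈ pastOf f,
      D.dist p.2 r.2 < ENNReal.ofReal (r.1 - p.1) ∧ D.dist q.2 r.2 < ENNReal.ofReal (r.1 - q.1)) :
    g.IsIP (g.past (pastOf f)) := by
  have hsub := pastOf_subset_past hg hcl f
  refine isIP_of_directed ⟨?_, (past_past_eq hg hcl _).symm⟩ ?_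
  · obtain ⟨x⟩ := ‹Nonempty M›
    exact ⟨(f x - 1, x), hsub (show f x - 1 < f x by linarith)⟩
  · rintro p ⟨p', hp', hpp'⟩ q ⟨q', hq', hqq'⟩
    obtain ⟨r, hr, h1, h2⟩ := hdir p' hp' q' hq'
    exact ⟨r, hsub hr, hpp'.trans (chron_of_dist_lt hg hcl h1),
      hqq'.trans (chron_of_dist_lt hg hcl h2)⟩

end SplitMetric

end PastSets

/-! ### Limits of the functions `T - d⁺(·, c)` -/

section Asymptotic

variable {n : ℕ} {M : Type*} [TopologicalSpace M] [ChartedSpace (EuclideanSpace ℝ (Fin n)) M]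
  [IsManifold (𝓡 n) ∞ M] {D : StationaryData n M}

theorem SplitMetric.Chron.toReal_dist_le {g : SplitMetric n M}
    {α : ℝ → ℝ} (hα : Continuous α) (hα_pos : ∀ t, 0 < α t) (hg : g.IsSpacetime)
    (hop : g.Prec (D.gop α)) {p q : ℝ × M} (h : g.Chron p q) :
    (D.dist p.2 q.2).toReal ≤ ∫ s in p.1..q.1, 1 / α s := by
  obtain ⟨h1, h2⟩ := h.lt_and_dist_le hα hα_pos hg hop
  have h3 : 0 ≤ ∫ s in p.1..q.1, 1 / α s :=
    intervalIntegral.integral_nonneg h1.le fun s _ => (one_div_pos.2 (hα_pos s)).le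
  exact ENNReal.toReal_le_of_le_ofReal h3 h2

namespace StationaryData

/-- `f` is the limit of the functions `T i - d⁺(·, c i)`, and the events `(T i - ε, c i)` lie in
`P_cl(f)` from some index on. Busemann functions and the functions `Ω - d_Q⁺(·, x)` are both of this
kind. -/
def IsAsymptotic (D : StationaryData n M) {ι : Type*} (l : Filter ι) (T : ι → ℝ) (c : ι → M)
    (f : M → ℝ) : Prop :=
  (∀ y, Tendsto (fun i => T i - (D.dist y (c i)).toReal) l (𝓝 (f y))) ∧
    ∀ ε > 0, ∀ᶠ i in l, T i - ε < f (c i)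

theorem IsAsymptotic.add_const {ι : Type*} {l : Filter ι} {T : ι → ℝ} {c : ι → M} {f : M → ℝ}
    (h : D.IsAsymptotic l T c f) (k : ℝ) :
    D.IsAsymptotic l (fun i => T i + k) c fun y => f y + k := by
  refine ⟨fun y => ?_, fun ε hε => ?_⟩
  · refine ((h.1 y).add_const k).congr fun i => ?_
    ring
  · filter_upwards [h.2 ε hε] with i hi
    linarith

theorem limDist_le (D : StationaryData n M) (y z : M) (σ : D.Cau) :
    D.limDist y σ ≤ D.dist y z + D.limDist z σ :=
  le_of_tendsto_of_tendsto' (D.tendsto_limDist y σ) ((D.tendsto_limDist z σ).const_add _)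
    fun _ => D.dist_triangle _ _ _

theorem IsBusemannAlong.dist_le {a : ℝ} {U : Set ℝ} {l : Filter ℝ} {c : ℝ → M} {f : M → ℝ}
    (h : D.IsBusemannAlong a U l c f) (hU : OrdConnected U) (haU : a ∈ U) {s t : ℝ} (has : a ≤ s)
    (hst : s ≤ t) (ht : t ∈ U) : D.dist (c s) (c t) ≤ ENNReal.ofReal (t - s) := by
  have hmem : ∀ r ∈ Icc s t, r ∈ U ∧ a ≤ r := fun r hr =>
    ⟨hU.out haU ht ⟨has.trans hr.1, hr.2⟩, has.trans hr.1⟩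
  have := dist_le_of_speed_le (K := 1) hst (fun r hr => (h.1 r (hmem r hr).1 (hmem r hr).2).1)
    (fun r hr => (h.1 r (hmem r hr).1 (hmem r hr).2).2.le)
  rwa [one_mul] at this

/-- The function `t - d⁺(y, c(t))` is monotone in `t`, so that the Busemann function at `c(u)` is at
least `u`. -/
theorem IsBusemannAlong.isAsymptotic {a : ℝ} {c : ℝ → M} {f : M → ℝ}
    (h : D.IsBusemannAlong a univ atTop c f) : D.IsAsymptotic atTop id c f := by
  refine ⟨h.2, fun ε hε => ?_⟩
  filter_upwards [eventually_ge_atTop a] with u hu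
  have : u ≤ f (c u) := by
    refine ge_of_tendsto (h.2 (c u)) ?_
    filter_upwards [eventually_ge_atTop u] with t ht
    have := ENNReal.toReal_le_of_le_ofReal (sub_nonneg.2 ht)
      (h.dist_le ordConnected_univ (mem_univ a) hu ht (mem_univ t))
    linarith
  simp only [id]
  linarith

theorem IsComplete.cauchyBoundary_eq_empty {D : StationaryData n M}
    (hD : D.IsComplete) : D.cauchyBoundary = ∅ := by
  refine eq_empty_of_forall_notMem fun ξ hξ => hξ ?_
  induction ξ using Quotient.inductionOn with | _ σ
  obtain ⟨x, hx⟩ := hD σ.1 σ.2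
  have hsmall : ∀ ε : ℝ≥0∞, 0 < ε → ∀ᶠ y in 𝓝 x, D.dist x y < ε ∧ D.dist y x < ε := by
    intro ε hε
    obtain ⟨r, hr0, hr⟩ := ENNReal.lt_iff_exists_nnreal_btwn.1 hε
    filter_upwards [D.eventually_dist_lt x (ε := r) (by exact_mod_cast hr0)] with y hy
    rw [ENNReal.ofReal_coe_nnreal] at hy
    exact ⟨hy.1.trans hr, hy.2.trans hr⟩
  refine ⟨x, Quotient.sound ⟨?_, ?_⟩⟩
  · have h0 : D.limDist x σ = 0 := by
      refine tendsto_nhds_unique (D.tendsto_limDist x σ)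
        (ENNReal.tendsto_nhds_zero.2 fun ε hε => ?_)
      exact (hx.eventually (hsmall ε hε)).mono fun k hk => hk.1.le
    exact (tendsto_const_nhds (x := D.limDist x σ)).trans_eq (congrArg 𝓝 h0)
  · refine ENNReal.tendsto_nhds_zero.2 fun ε hε => ?_
    filter_upwards [hx.eventually (hsmall ε hε)] with k hk
    exact (limsup_const _).trans_le hk.2.le

end StationaryData

variable [ConnectedSpace M]

namespace StationaryData

theorem toReal_dist_triangle (D : StationaryData n M) (x y z : M) :
    (D.dist x z).toReal ≤ (D.dist x y).toReal + (D.dist y z).toReal := by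
  rw [← ENNReal.toReal_add (D.dist_lt_top x y).ne (D.dist_lt_top y z).ne]
  exact ENNReal.toReal_mono (ENNReal.add_ne_top.2 ⟨(D.dist_lt_top x y).ne, (D.dist_lt_top y z).ne⟩)
    (D.dist_triangle x y z)

theorem dist_lt_ofReal_iff (D : StationaryData n M) {x y : M} {r : ℝ} :
    D.dist x y < ENNReal.ofReal r ↔ (D.dist x y).toReal < r :=
  ENNReal.lt_ofReal_iff_toReal_lt (D.dist_lt_top x y).ne

namespace IsAsymptotic

variable {ι : Type*} {l : Filter ι} [l.NeBot] {T : ι → ℝ} {c : ι → M} {f : M → ℝ}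

theorem sub_dist_le (h : D.IsAsymptotic l T c f) (y z : M) : f z - (D.dist y z).toReal ≤ f y :=
  le_of_tendsto_of_tendsto' ((h.1 z).sub_const _) (h.1 y) fun i => by
    have := D.toReal_dist_triangle y z (c i)
    linarith

theorem directed (h : D.IsAsymptotic l T c f) :
    ∀ p ∈ pastOf f, ∀ q ∈ pastOf f, ∃ r ∈ pastOf f,
      D.dist p.2 r.2 < ENNReal.ofReal (r.1 - p.1) ∧
      D.dist q.2 r.2 < ENNReal.ofReal (r.1 - q.1) := by
  intro p hp q hq
  have hp' : p.1 < f p.2 := hp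
  have hq' : q.1 < f q.2 := hq
  set δ := min (f p.2 - p.1) (f q.2 - q.1) / 2 with hδ
  have hδ0 : 0 < δ := half_pos (lt_min (by linarith) (by linarith))
  have h1 : δ + δ ≤ f p.2 - p.1 := by rw [hδ, add_halves]; exact min_le_left _ _
  have h2 : δ + δ ≤ f q.2 - q.1 := by rw [hδ, add_halves]; exact min_le_right _ _
  obtain ⟨i, hi1, hi2, hi3⟩ :=
    (((h.1 p.2).eventually (lt_mem_nhds (show p.1 + δ < _ by linarith))).and
    (((h.1 q.2).eventually (lt_mem_nhds (show q.1 + δ < _ by linarith))).and (h.2 δ hδ0))).exists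
  refine ⟨(T i - δ, c i), hi3, ?_, ?_⟩
  · exact D.dist_lt_ofReal_iff.2 (by linarith)
  · exact D.dist_lt_ofReal_iff.2 (by linarith)

end IsAsymptotic

end StationaryData

namespace SplitMetric

variable {g : SplitMetric n M} {α : ℝ → ℝ}

/-- The whole spacetime is a terminal indecomposable past set. -/
theorem univ_mem_futureBoundary (hα : Continuous α) (hα_pos : ∀ t, 0 < α t) (hg : g.IsSpacetime)
    (hcl : D.gcl.Prec g) (hop : g.Prec (D.gop α)) : univ ∈ g.futureBoundary := by
  refine ⟨isIP_of_directed ⟨univ_nonempty, ?_⟩ ?_, ?_⟩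
  · exact (eq_univ_of_forall fun p => (⟨(p.1 + 1, p.2), mem_univ _,
      chron_vertical hg hcl p.2 (lt_add_one _)⟩ : p ∈ g.past univ)).symm
  · intro p _ q _
    refine ⟨(max p.1 (q.1 + (D.dist q.2 p.2).toReal) + 1, p.2), mem_univ _,
      chron_vertical hg hcl p.2 ?_, chron_of_dist_lt hg hcl (D.dist_lt_ofReal_iff.2 ?_)⟩
    · exact (le_max_left _ _).trans_lt (lt_add_one _)
    · have := le_max_right p.1 (q.1 + (D.dist q.2 p.2).toReal)
      linarith
  · rintro ⟨p, hp⟩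
    obtain ⟨q, rfl, hq⟩ : (p.1 + 1, p.2) ∈ g.past {p} := hp ▸ mem_univ _
    have := (hq.lt_and_dist_le hα hα_pos hg hop).1
    simp at this
    linarith

end SplitMetric

/-! ### The part of the boundary over the Cauchy completion -/

namespace StationaryData

theorem limDist_lt_top (D : StationaryData n M) (y : M) (σ : D.Cau) : D.limDist y σ < ⊤ := by
  obtain ⟨k, hk⟩ := ((CauLE.refl D σ).eventually (gt_mem_nhds (zero_lt_one (α := ℝ≥0∞)))).exists
  exact (D.limDist_le y (σ.1 k) σ).trans_lt
    (ENNReal.add_lt_top.2 ⟨D.dist_lt_top _ _, hk.trans ENNReal.one_lt_top⟩)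

theorem toReal_limDist_le (D : StationaryData n M) (y z : M) (σ : D.Cau) :
    (D.limDist y σ).toReal ≤ (D.dist y z).toReal + (D.limDist z σ).toReal := by
  rw [← ENNReal.toReal_add (D.dist_lt_top _ _).ne (D.limDist_lt_top _ _).ne]
  exact ENNReal.toReal_mono (ENNReal.add_ne_top.2 ⟨(D.dist_lt_top _ _).ne,
    (D.limDist_lt_top _ _).ne⟩) (D.limDist_le y z σ)

theorem tendsto_toReal_limDist (D : StationaryData n M) (y : M) (σ : D.Cau) :
    Tendsto (fun m => (D.dist y (σ.1 m)).toReal) atTop (𝓝 (D.limDist y σ).toReal) :=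
  (ENNReal.tendsto_toReal (D.limDist_lt_top y σ).ne).comp (D.tendsto_limDist y σ)

theorem cauLE_iff {σ σ' : D.Cau} :
    D.CauLE σ σ' ↔ Tendsto (fun k => (D.limDist (σ.1 k) σ').toReal) atTop (𝓝 0) := by
  rw [CauLE, ← ENNReal.tendsto_toReal_iff (fun k => (D.limDist_lt_top _ _).ne) ENNReal.zero_ne_top,
    ENNReal.toReal_zero]

theorem isAsymptotic_cauchyFun (Ω : ℝ) (σ : D.Cau) :
    D.IsAsymptotic atTop (fun _ => Ω) σ.1 (D.cauchyFun Ω (Quotient.mk _ σ)) := by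
  refine ⟨fun y => (D.tendsto_toReal_limDist y σ).const_sub Ω, fun ε hε => ?_⟩
  filter_upwards [(cauLE_iff.1 (CauLE.refl D σ)).eventually (gt_mem_nhds hε)] with k hk
  exact sub_lt_sub_left hk Ω

end StationaryData

namespace SplitMetric

variable {g : SplitMetric n M} {α : ℝ → ℝ}

/-- The past of an event is the past of the corresponding set of `g_cl`. -/
theorem past_singleton_eq_past_pastOf (hg : g.IsSpacetime) (hcl : D.gcl.Prec g) (T : ℝ) (z : M) :
    g.past {(T, z)} = g.past (pastOf (D.cauchyFun T (D.ofPoint z))) := by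
  have hz : ∀ y, D.cauchyFun T (D.ofPoint z) y = T - (D.dist y z).toReal := fun y => by
    have : D.distQ y (D.ofPoint z) = D.dist y z := limsup_const (D.dist y z)
    rw [StationaryData.cauchyFun, this]
  ext p
  constructor
  · rintro ⟨q, rfl, hq⟩
    obtain ⟨δ, hδ, hδ0⟩ := ((hq.eventually_past hg).filter_mono nhdsWithin_le_nhds |>.and
      (self_mem_nhdsWithin : Ioi (0 : ℝ) ∈ 𝓝[>] 0)).exists
    refine ⟨_, ?_, hδ⟩
    change T - δ < _
    rw [hz, D.dist_self, ENNReal.toReal_zero]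
    exact sub_lt_sub_left hδ0 _
  · rintro ⟨q, hq, hpq⟩
    refine ⟨(T, z), rfl, hpq.trans (chron_of_dist_lt hg hcl (D.dist_lt_ofReal_iff.2 ?_))⟩
    have : q.1 < _ := hq
    rw [hz] at this
    linarith

/-- The set `I⁻(P_cl(Ω - d_Q⁺(·, x)))` narrows down to the pair `(Ω, x)` as time tends to `Ω`. -/
theorem lt_and_toReal_limDist_le (hα : Continuous α) (hα_pos : ∀ t, 0 < α t) (hg : g.IsSpacetime)
    (hop : g.Prec (D.gop α)) {Ω : ℝ} {σ : D.Cau} {p : ℝ × M}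
    (hp : p ∈ g.past (pastOf (D.cauchyFun Ω (Quotient.mk _ σ)))) :
    p.1 < Ω ∧ (D.limDist p.2 σ).toReal ≤ (∫ s in p.1..Ω, 1 / α s) + (Ω - p.1) := by
  obtain ⟨q, hq, hpq⟩ := hp
  have hq' : q.1 < Ω - (D.limDist q.2 σ).toReal := hq
  have h0 : 0 ≤ (D.limDist q.2 σ).toReal := ENNReal.toReal_nonneg
  have h1 := (hpq.lt_and_dist_le hα hα_pos hg hop).1
  have h2 := hpq.toReal_dist_le hα hα_pos hg hop
  have h3 := D.toReal_limDist_le p.2 q.2 σ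
  have hcont : Continuous fun s => 1 / α s := continuous_const.div hα fun s => (hα_pos s).ne'
  have h4 := intervalIntegral.integral_add_adjacent_intervals
    (hcont.intervalIntegrable (μ := MeasureTheory.volume) p.1 q.1) (hcont.intervalIntegrable q.1 Ω)
  have h5 : 0 ≤ ∫ s in q.1..Ω, 1 / α s :=
    intervalIntegral.integral_nonneg (by linarith) fun s _ => (one_div_pos.2 (hα_pos s)).le
  exact ⟨by linarith, by linarith⟩

/-- An inclusion between two sets `I⁻(P_cl(Ω - d_Q⁺(·, x)))` compares the times and, if these agree,
yields one half of the equivalence of the forward Cauchy sequences. -/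
theorem le_and_cauLE_of_past_subset (hα : Continuous α) (hα_pos : ∀ t, 0 < α t)
    (hg : g.IsSpacetime) (hcl : D.gcl.Prec g) (hop : g.Prec (D.gop α)) {Ω Ω' : ℝ} {σ σ' : D.Cau}
    (h : g.past (pastOf (D.cauchyFun Ω (Quotient.mk _ σ))) ⊆
      g.past (pastOf (D.cauchyFun Ω' (Quotient.mk _ σ')))) :
    Ω ≤ Ω' ∧ (Ω = Ω' → D.CauLE σ σ') := by
  have key : ∀ ε > 0, ∀ᶠ k in atTop, Ω - ε < Ω' ∧ (D.limDist (σ.1 k) σ').toReal ≤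
      (∫ s in (Ω - ε)..Ω', 1 / α s) + (Ω' - (Ω - ε)) := fun ε hε => by
    filter_upwards [(StationaryData.isAsymptotic_cauchyFun Ω σ).2 ε hε] with k hk
    exact lt_and_toReal_limDist_le hα hα_pos hg hop (p := (Ω - ε, σ.1 k))
      (h (pastOf_subset_past hg hcl _ hk))
  refine ⟨le_of_forall_pos_lt_add fun ε hε => ?_, ?_⟩
  · obtain ⟨k, hk, -⟩ := (key ε hε).exists
    linarith
  · rintro rfl
    have hcont : Continuous fun s => 1 / α s := continuous_const.div hα fun s => (hα_pos s).ne'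
    have hlim : Tendsto (fun ε => (∫ s in (Ω - ε)..Ω, 1 / α s) + (Ω - (Ω - ε))) (𝓝[>] 0) (𝓝 0) := by
      have h1 : Continuous fun ε => (∫ s in (Ω - ε)..Ω, 1 / α s) + (Ω - (Ω - ε)) := by
        have h2 : Continuous fun t => ∫ s in Ω..t, 1 / α s :=
          intervalIntegral.continuous_primitive (fun a b => hcont.intervalIntegrable a b) Ω
        have h3 : (fun ε => ∫ s in (Ω - ε)..Ω, 1 / α s) =
            fun ε => -∫ s in Ω..(Ω - ε), 1 / α s :=
          funext fun ε => intervalIntegral.integral_symm _ _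
        rw [show (fun ε => (∫ s in (Ω - ε)..Ω, 1 / α s) + (Ω - (Ω - ε))) =
          fun ε => (-∫ s in Ω..(Ω - ε), 1 / α s) + (Ω - (Ω - ε)) from
          funext fun ε => by rw [congrFun h3 ε]]
        exact (h2.comp (continuous_const.sub continuous_id)).neg.add (by fun_prop)
      have h4 := h1.tendsto 0
      simp only [sub_zero, sub_self, intervalIntegral.integral_same, add_zero] at h4
      exact h4.mono_left nhdsWithin_le_nhds
    rw [StationaryData.cauLE_iff]
    refine (tendsto_order.2 ⟨fun r hr => Eventually.of_forall fun k =>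
      hr.trans_le ENNReal.toReal_nonneg, fun r hr => ?_⟩)
    obtain ⟨ε, hε, hε0⟩ := ((hlim.eventually (gt_mem_nhds hr)).and
      (self_mem_nhdsWithin : Ioi (0 : ℝ) ∈ 𝓝[>] 0)).exists
    exact (key ε hε0).mono fun k hk => hk.2.trans_lt hε

/-- The pasts `I⁻(P_cl(Ω - d_Q⁺(·, x)))`, for `x` in the Cauchy completion, are pairwise
distinct. -/
theorem eq_of_past_pastOf_cauchyFun_eq (hα : Continuous α) (hα_pos : ∀ t, 0 < α t)
    (hg : g.IsSpacetime) (hcl : D.gcl.Prec g) (hop : g.Prec (D.gop α)) {Ω Ω' : ℝ}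
    {x x' : D.CauchyCompletion}
    (h : g.past (pastOf (D.cauchyFun Ω x)) = g.past (pastOf (D.cauchyFun Ω' x'))) :
    Ω = Ω' ∧ x = x' := by
  induction x using Quotient.inductionOn with | _ σ
  induction x' using Quotient.inductionOn with | _ σ'
  obtain ⟨h1, h2⟩ := le_and_cauLE_of_past_subset hα hα_pos hg hcl hop h.subset
  obtain ⟨h3, h4⟩ := le_and_cauLE_of_past_subset hα hα_pos hg hcl hop h.symm.subset
  have h5 := h1.antisymm h3
  exact ⟨h5, Quotient.sound ⟨h2 h5, h4 h5.symm⟩⟩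

theorem containsCone_cauchyBoundary (hα : Continuous α) (hα_pos : ∀ t, 0 < α t)
    (hg : g.IsSpacetime) (hcl : D.gcl.Prec g) (hop : g.Prec (D.gop α)) :
    ContainsCone g fun (Ω : ℝ) (x : D.cauchyBoundary) => D.cauchyFun Ω x.1 := by
  have hne : ∀ (Ω : ℝ) (x : D.CauchyCompletion), g.past (pastOf (D.cauchyFun Ω x)) ≠ univ := by
    intro Ω x h
    induction x using Quotient.inductionOn with | _ σ
    obtain ⟨y⟩ : Nonempty M := inferInstance
    have h1 : (Ω, y) ∈ g.past (pastOf (D.cauchyFun Ω (Quotient.mk _ σ))) := by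
      rw [h]
      exact mem_univ _
    exact lt_irrefl _ (lt_and_toReal_limDist_le hα hα_pos hg hop h1).1
  refine ⟨?_, ?_⟩
  · rintro (_ | ⟨Ω, x⟩) (_ | ⟨Ω', x'⟩) h
    · rfl
    · exact absurd h.symm (hne _ _)
    · exact absurd h (hne _ _)
    · obtain ⟨rfl, h2⟩ := eq_of_past_pastOf_cauchyFun_eq hα hα_pos hg hcl hop h
      rw [Subtype.ext h2]
  · rintro (_ | ⟨Ω, x, hx⟩)
    · exact univ_mem_futureBoundary hα hα_pos hg hcl hop
    · refine ⟨?_, ?_⟩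
      · induction x using Quotient.inductionOn with | _ σ
        exact isIP_past_pastOf hg hcl (StationaryData.isAsymptotic_cauchyFun Ω σ).directed
      · rintro ⟨⟨T, z⟩, h⟩
        rw [past_singleton_eq_past_pastOf hg hcl] at h
        exact hx ⟨z, (eq_of_past_pastOf_cauchyFun_eq hα hα_pos hg hcl hop h).2.symm⟩

end SplitMetric

/-! ### Busemann functions -/

namespace StationaryData

/-- A Busemann function of a curve with bounded time is given by a point of the Cauchy
completion. -/
theorem IsBusemannAlong.exists_eq_cauchyFun {a Ω : ℝ} (haΩ : a < Ω) {c : ℝ → M} {f : M → ℝ}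
    (h : D.IsBusemannAlong a (Iio Ω) (𝓝[<] Ω) c f) :
    ∃ x : D.CauchyCompletion, ∀ y, f y = D.cauchyFun Ω x y := by
  obtain ⟨u, hu, huI, hulim⟩ := exists_seq_strictMono_tendsto' haΩ
  have hσ : D.IsCauchy fun m => c (u m) := by
    intro ε hε
    have h1 : Tendsto (fun k => ENNReal.ofReal (Ω - u k)) atTop (𝓝 0) := by
      have := ENNReal.tendsto_ofReal (hulim.const_sub Ω)
      simpa using this
    obtain ⟨N, hN⟩ := eventually_atTop.1 (h1.eventually (gt_mem_nhds hε))
    refine ⟨N, fun k m hk hkm => lt_of_le_of_lt ?_ (hN k hk)⟩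
    refine (h.dist_le ordConnected_Iio haΩ (huI k).1.le (hu.monotone hkm) (huI m).2).trans ?_
    exact ENNReal.ofReal_le_ofReal (by linarith [(huI m).2])
  refine ⟨Quotient.mk _ ⟨_, hσ⟩, fun y => ?_⟩
  have hu' : Tendsto u atTop (𝓝[<] Ω) :=
    tendsto_nhdsWithin_iff.2 ⟨hulim, Eventually.of_forall fun m => (huI m).2⟩
  exact tendsto_nhds_unique ((h.2 y).comp hu')
    (hulim.sub (D.tendsto_toReal_limDist y ⟨_, hσ⟩))

/-- The classes in the proper Busemann boundary only contain Busemann functions of curves defined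
for all large times. -/
theorem exists_isAsymptotic_of_mem_properBusemannBoundary {f : D.BusemannFun}
    (hf : Quotient.mk D.busSetoid f ∈ D.properBusemannBoundary) :
    ∃ c : ℝ → M, D.IsAsymptotic atTop id c f.1 := by
  rcases f.2 with ⟨a, Ω, c, haΩ, h⟩ | ⟨a, c, h⟩
  · obtain ⟨x, hx⟩ := h.exists_eq_cauchyFun haΩ
    by_cases hxM : x ∈ range D.ofPoint
    · obtain ⟨z, rfl⟩ := hxM
      exact absurd ⟨z, f, Ω, rfl, hx⟩ hf.1
    · exact absurd ⟨x, hxM, f, Ω, rfl, hx⟩ hf.2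
  · exact ⟨c, h.isAsymptotic⟩

/-- For a curve defined for all large times, `t - d⁺(x₀, c(t))` tends to infinity if `d⁺(x₀, ·)` is
bounded. -/
theorem properBusemannBoundary_eq_empty (hb : D.IsBounded) : D.properBusemannBoundary = ∅ := by
  refine eq_empty_of_forall_notMem fun ξ hξ => ?_
  induction ξ using Quotient.inductionOn with | _ f
  obtain ⟨c, hc⟩ := exists_isAsymptotic_of_mem_properBusemannBoundary hξ
  obtain ⟨x₀, r, hr⟩ := hb
  refine not_tendsto_nhds_of_tendsto_atTop ?_ _ (hc.1 x₀)
  refine tendsto_atTop_mono (fun t => ?_) (tendsto_atTop_add_const_right atTop (-r : ℝ) tendsto_id)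
  have : (D.dist x₀ (c t)).toReal ≤ r := ENNReal.toReal_le_coe_of_le_coe (hr _).le
  linarith

end StationaryData

namespace SplitMetric

variable {g : SplitMetric n M} {α : ℝ → ℝ} {ι : Type*} {l : Filter ι}
  [l.NeBot] {T : ι → ℝ} {c : ι → M} {f : M → ℝ}

/-- The past for `g` of `P_cl(f)` exceeds `P_cl(f)` at time `t` at most by the tail of the integral
of `|1/α - 1|` from `t` on. -/
theorem le_add_tail (hα : Continuous α) (hα_pos : ∀ t, 0 < α t)
    (hint : MeasureTheory.IntegrableOn (fun s => 1 / α s - 1) (Ioi 0)) (hg : g.IsSpacetime)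
    (hop : g.Prec (D.gop α)) (hf : D.IsAsymptotic l T c f) {p : ℝ × M} (hp0 : 0 ≤ p.1)
    (hp : p ∈ g.past (pastOf f)) : p.1 ≤ f p.2 + ∫ s in Ioi p.1, |1 / α s - 1| := by
  obtain ⟨q, hq, hpq⟩ := hp
  have hq' : q.1 < f q.2 := hq
  have h1 := (hpq.lt_and_dist_le hα hα_pos hg hop).1
  have h2 := hpq.toReal_dist_le hα hα_pos hg hop
  have h3 := hf.sub_dist_le p.2 q.2
  have hcont : Continuous fun s => 1 / α s := continuous_const.div hα fun s => (hα_pos s).ne'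
  have h4 : ∫ s in p.1..q.1, 1 / α s = (∫ s in p.1..q.1, (1 / α s - 1)) + (q.1 - p.1) := by
    rw [intervalIntegral.integral_sub (hcont.intervalIntegrable _ _) (by simp)]
    simp
  have h5 : ∫ s in p.1..q.1, (1 / α s - 1) ≤ ∫ s in Ioi p.1, |1 / α s - 1| := by
    have hint' : MeasureTheory.IntegrableOn (fun s => |1 / α s - 1|) (Ioi p.1) :=
      (hint.mono_set (Ioi_subset_Ioi hp0)).abs
    rw [intervalIntegral.integral_of_le h1.le]
    calc ∫ s in Ioc p.1 q.1, (1 / α s - 1) ≤ ∫ s in Ioc p.1 q.1, |1 / α s - 1| :=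
          MeasureTheory.setIntegral_mono
            ((hint.mono_set (Ioi_subset_Ioi hp0)).mono_set Ioc_subset_Ioi_self)
            (hint'.mono_set Ioc_subset_Ioi_self) fun s => le_abs_self _
      _ ≤ _ := MeasureTheory.setIntegral_mono_set hint'
          (Eventually.of_forall fun s => abs_nonneg _) Ioc_subset_Ioi_self.eventuallyLE
  linarith

theorem tendsto_tail (hint : MeasureTheory.IntegrableOn (fun s => 1 / α s - 1) (Ioi 0)) :
    Tendsto (fun t : ℝ => ∫ s in Ioi t, |1 / α s - 1|) atTop (𝓝 0) := by
  have h := MeasureTheory.intervalIntegral_tendsto_integral_Ioi 0 hint.abs tendsto_id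
  have h' := h.const_sub (∫ s in Ioi (0 : ℝ), |1 / α s - 1|)
  rw [sub_self] at h'
  refine h'.congr' ?_
  filter_upwards [eventually_ge_atTop 0] with t ht
  have h1 := intervalIntegral.integral_interval_add_Ioi (b := t) hint.abs
    (hint.mono_set (Ioi_subset_Ioi ht)).abs
  simp only [id]
  linarith

/-- Although `I⁻(P_cl(f'))` may exceed `P_cl(f')`, the inequality between `f` and `f'` carries no
error: it is tested at the events `(T i - δ, c i)`, and the tail at time `T i - δ` tends to zero. -/
theorem le_of_past_pastOf_subset {ι' : Type*} {l' : Filter ι'} [l'.NeBot] {T' : ι' → ℝ}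
    {c' : ι' → M} {f' : M → ℝ} (hα : Continuous α) (hα_pos : ∀ t, 0 < α t)
    (hint : MeasureTheory.IntegrableOn (fun s => 1 / α s - 1) (Ioi 0)) (hg : g.IsSpacetime)
    (hcl : D.gcl.Prec g) (hop : g.Prec (D.gop α)) (hf : D.IsAsymptotic l T c f)
    (hT : Tendsto T l atTop) (hf' : D.IsAsymptotic l' T' c' f')
    (h : g.past (pastOf f) ⊆ g.past (pastOf f')) (y : M) : f y ≤ f' y := by
  refine le_of_forall_pos_le_add fun δ hδ => ?_
  have hT' : Tendsto (fun i => T i - δ) l atTop := tendsto_atTop_add_const_right l (-δ) hT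
  have hlim := (hf.1 y).sub ((tendsto_tail hint).comp hT')
  rw [sub_zero] at hlim
  refine le_of_tendsto hlim ?_
  filter_upwards [hf.2 δ hδ, hT'.eventually_ge_atTop 0] with i hi hi0
  have h1 := le_add_tail hα hα_pos hint hg hop hf' (p := (T i - δ, c i)) hi0
    (h (pastOf_subset_past hg hcl _ hi))
  have h2 := hf'.sub_dist_le y (c i)
  simp only [Function.comp] at h1 ⊢
  linarith

/-- A past `I⁻(P_cl(f))` of an asymptotic function with unbounded times is a TIP. -/
theorem past_pastOf_mem_futureBoundary (hα : Continuous α) (hα_pos : ∀ t, 0 < α t)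
    (hg : g.IsSpacetime) (hcl : D.gcl.Prec g) (hop : g.Prec (D.gop α))
    (hf : D.IsAsymptotic l T c f) (hT : Tendsto T l atTop) :
    g.past (pastOf f) ∈ g.futureBoundary := by
  refine ⟨isIP_past_pastOf hg hcl hf.directed, ?_⟩
  rintro ⟨p, hp⟩
  obtain ⟨i, hi, hi'⟩ := ((hf.2 1 one_pos).and (hT.eventually_ge_atTop (p.1 + 1))).exists
  have h1 : (T i - 1, c i) ∈ g.past (pastOf f) := pastOf_subset_past hg hcl _ hi
  rw [hp] at h1
  obtain ⟨q, rfl, hq⟩ := h1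
  have := (hq.lt_and_dist_le hα hα_pos hg hop).1
  simp only at this
  linarith

theorem past_pastOf_ne_univ (hα : Continuous α) (hα_pos : ∀ t, 0 < α t)
    (hint : MeasureTheory.IntegrableOn (fun s => 1 / α s - 1) (Ioi 0)) (hg : g.IsSpacetime)
    (hop : g.Prec (D.gop α)) (hf : D.IsAsymptotic l T c f) : g.past (pastOf f) ≠ univ := by
  intro h
  obtain ⟨y⟩ : Nonempty M := inferInstance
  obtain ⟨t, ht0, ht1, ht2⟩ := ((eventually_ge_atTop (0 : ℝ)).and
    (((tendsto_tail hint).eventually (gt_mem_nhds one_pos)).and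
      (eventually_ge_atTop (f y + 1)))).exists
  have := le_add_tail hα hα_pos hint hg hop hf (p := (t, y)) ht0 (h ▸ mem_univ _)
  simp only at this
  linarith

theorem containsCone_properBusemannBoundary (hα : Continuous α) (hα_pos : ∀ t, 0 < α t)
    (hint : MeasureTheory.IntegrableOn (fun s => 1 / α s - 1) (Ioi 0)) (hg : g.IsSpacetime)
    (hcl : D.gcl.Prec g) (hop : g.Prec (D.gop α)) (b : D.properBusemannBoundary → D.BusemannFun)
    (hb : ∀ ξ, Quotient.mk D.busSetoid (b ξ) = ξ.1) :
    ContainsCone g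
      (fun (k : ℝ) (ξ : D.properBusemannBoundary) (y : M) => (b ξ).1 y + k) := by
  have hasy : ∀ (k : ℝ) (ξ : D.properBusemannBoundary), ∃ c : ℝ → M,
      D.IsAsymptotic atTop (fun u => id u + k) c fun y => (b ξ).1 y + k := fun k ξ => by
    obtain ⟨c, hc⟩ := StationaryData.exists_isAsymptotic_of_mem_properBusemannBoundary
      (f := b ξ) (by rw [hb ξ]; exact ξ.2)
    exact ⟨c, hc.add_const k⟩
  have hT : ∀ k : ℝ, Tendsto (fun u : ℝ => id u + k) atTop atTop := fun k =>
    tendsto_atTop_add_const_right atTop k tendsto_id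
  have hne : ∀ (k : ℝ) (ξ : D.properBusemannBoundary),
      g.past (pastOf fun y => (b ξ).1 y + k) ≠ univ := fun k ξ => by
    obtain ⟨c, hc⟩ := hasy k ξ
    exact past_pastOf_ne_univ hα hα_pos hint hg hop hc
  refine ⟨?_, ?_⟩
  · rintro (_ | ⟨k, ξ⟩) (_ | ⟨k', ξ'⟩) h
    · rfl
    · exact absurd h.symm (hne _ _)
    · exact absurd h (hne _ _)
    · replace h : g.past (pastOf fun y => (b ξ).1 y + k) =
        g.past (pastOf fun y => (b ξ').1 y + k') := h
      obtain ⟨c, hc⟩ := hasy k ξ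
      obtain ⟨c', hc'⟩ := hasy k' ξ'
      have heq : ∀ y, (b ξ).1 y + k = (b ξ').1 y + k' := fun y => le_antisymm
        (le_of_past_pastOf_subset hα hα_pos hint hg hcl hop hc (hT k) hc' h.subset y)
        (le_of_past_pastOf_subset hα hα_pos hint hg hcl hop hc' (hT k') hc h.symm.subset y)
      have hξ : ξ = ξ' := by
        refine Subtype.ext ?_
        rw [← hb ξ, ← hb ξ']
        exact Quotient.sound ⟨k - k', fun y => by linarith [heq y]⟩
      subst hξ
      obtain ⟨y⟩ : Nonempty M := inferInstance
      have : k = k' := by linarith [heq y]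
      rw [this]
  · rintro (_ | ⟨k, ξ⟩)
    · exact univ_mem_futureBoundary hα hα_pos hg hcl hop
    · obtain ⟨c, hc⟩ := hasy k ξ
      exact past_pastOf_mem_futureBoundary hα hα_pos hg hcl hop hc (hT k)

end SplitMetric

end Asymptotic

/-! ### Compactness of forward balls -/

section Compactness

variable {n : ℕ} {M : Type*} [TopologicalSpace M] [ChartedSpace (EuclideanSpace ℝ (Fin n)) M]
  [IsManifold (𝓡 n) ∞ M]

namespace StationaryData

variable {D : StationaryData n M}

/-- The forward ball of radius `R` around `x` is contained in a compact set. -/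
def HasCompactBall (D : StationaryData n M) (x : M) (R : ℝ) : Prop :=
  ∃ K, IsCompact K ∧ ∀ y, D.dist x y < ENNReal.ofReal R → y ∈ K

theorem dist_le_of_mem_closure {x y : M} {ρ : ℝ}
    (hy : y ∈ closure {y | D.dist x y < ENNReal.ofReal ρ}) : D.dist x y ≤ ENNReal.ofReal ρ := by
  refine ENNReal.le_of_forall_pos_le_add fun ε hε _ => ?_
  obtain ⟨y', hy', hy'ρ⟩ := mem_closure_iff_nhds.1 hy _
    (D.eventually_dist_lt y (ε := ε) (by exact_mod_cast hε))
  calc D.dist x y ≤ D.dist x y' + D.dist y' y := D.dist_triangle _ _ _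
    _ ≤ ENNReal.ofReal ρ + ENNReal.ofReal ε := add_le_add (le_of_lt hy'ρ) hy'.2.le
    _ = _ := by rw [ENNReal.ofReal_coe_nnreal]

/-- If the balls of radius `R / 2` around all points of the ball of radius `R` are relatively
compact, then so is the ball of radius `R`: starting from radius `R / 2`, the radius can be
increased twice by `R / 4`. -/
theorem HasCompactBall.of_half [T2Space M] {x : M} {R : ℝ} (hR : 0 < R)
    (h : ∀ y, D.dist x y ≤ ENNReal.ofReal R → D.HasCompactBall y (R / 2)) :
    D.HasCompactBall x R := by
  have step : ∀ ρ, 0 < ρ → ρ ≤ R → D.HasCompactBall x ρ → D.HasCompactBall x (ρ + R / 4) := by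
    rintro ρ hρ hρR ⟨K, hK, hball⟩
    have hcl : IsCompact (closure {y | D.dist x y < ENNReal.ofReal ρ}) :=
      hK.of_isClosed_subset isClosed_closure (closure_minimal (fun y hy => hball y hy) hK.isClosed)
    have hunif : ∃ K', IsCompact K' ∧ ∀ m ∈ closure {y | D.dist x y < ENNReal.ofReal ρ},
        ∀ w, D.dist m w < ENNReal.ofReal (R / 4) → w ∈ K' := by
      refine hcl.induction_on (p := fun S => ∃ K', IsCompact K' ∧ ∀ m ∈ S,
        ∀ w, D.dist m w < ENNReal.ofReal (R / 4) → w ∈ K') ⟨∅, isCompact_empty, by simp⟩ ?_ ?_ ?_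
      · rintro s t hst ⟨K', hK', h'⟩
        exact ⟨K', hK', fun m hm => h' m (hst hm)⟩
      · rintro s t ⟨K₁, hK₁, h₁⟩ ⟨K₂, hK₂, h₂⟩
        refine ⟨K₁ ∪ K₂, hK₁.union hK₂, fun m hm w hw => ?_⟩
        rcases hm with hm | hm
        · exact Or.inl (h₁ m hm w hw)
        · exact Or.inr (h₂ m hm w hw)
      · intro y hy
        obtain ⟨K', hK', h'⟩ := h y
          ((dist_le_of_mem_closure hy).trans (ENNReal.ofReal_le_ofReal hρR))
        refine ⟨_, mem_nhdsWithin_of_mem_nhds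
          (D.eventually_dist_lt y (ε := R / 4) (by positivity)), K', hK', fun m hm w hw => ?_⟩
        refine h' w ((D.dist_triangle y m w).trans_lt ?_)
        calc D.dist y m + D.dist m w < ENNReal.ofReal (R / 4) + ENNReal.ofReal (R / 4) :=
              ENNReal.add_lt_add hm.1 hw
          _ = ENNReal.ofReal (R / 2) := by
            rw [← ENNReal.ofReal_add (by positivity) (by positivity)]
            congr 1
            ring
    obtain ⟨K', hK', h'⟩ := hunif
    refine ⟨K', hK', fun w hw => ?_⟩
    obtain ⟨m, hm, hmw⟩ := exists_between hρ (by positivity) hw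
    exact h' m (subset_closure hm) w hmw
  have h1 : D.HasCompactBall x (R / 2) := h x (by simp [dist_self])
  have h2 := step _ (by positivity) (by linarith) (step _ (by positivity) (by linarith) h1)
  rwa [show R / 2 + R / 4 + R / 4 = R by ring] at h2

/-- The Hopf–Rinow property: in a forward complete `(M, d⁺)` forward balls are relatively compact.
Otherwise there is a forward Cauchy sequence of centres of balls of radii `R / 2 ^ k` that are not
relatively compact, which is impossible near its limit. -/
theorem IsComplete.hasCompactBall [T2Space M] (hD : D.IsComplete) (x : M) {R : ℝ} (hR : 0 < R) :
    D.HasCompactBall x R := by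
  by_contra hx
  have hnext : ∀ (k : ℕ) (y : M), ∃ y', ¬ D.HasCompactBall y (R / 2 ^ k) →
      D.dist y y' ≤ ENNReal.ofReal (R / 2 ^ k) ∧ ¬ D.HasCompactBall y' (R / 2 ^ (k + 1)) := by
    intro k y
    by_cases hy : D.HasCompactBall y (R / 2 ^ k)
    · exact ⟨y, fun h => absurd hy h⟩
    · by_contra! hcon
      refine hy (HasCompactBall.of_half (by positivity) fun y' hy' => ?_)
      have := (hcon y').2 hy'
      rwa [pow_succ, ← div_div] at this
  choose next hnext using hnext
  let σ : ℕ → M := fun k => Nat.rec x (fun k y => next k y) k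
  have hσ : ∀ k, ¬ D.HasCompactBall (σ k) (R / 2 ^ k) := by
    intro k
    induction k with
    | zero => simpa [σ] using hx
    | succ k ih => exact (hnext k _ ih).2
  have hstep : ∀ k, D.dist (σ k) (σ (k + 1)) ≤ ENNReal.ofReal (R / 2 ^ k) :=
    fun k => (hnext k _ (hσ k)).1
  have hdist : ∀ k m, k ≤ m →
      D.dist (σ k) (σ m) ≤ ENNReal.ofReal (2 * R / 2 ^ k - 2 * R / 2 ^ m) := by
    intro k m hkm
    induction m, hkm using Nat.le_induction with
    | base => simp [dist_self]
    | succ m hkm ih =>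
      have h1 : 2 * R / 2 ^ m ≤ 2 * R / 2 ^ k := by
        have : (2 : ℝ) ^ k ≤ 2 ^ m := pow_le_pow_right₀ (by norm_num) hkm
        gcongr
      refine (D.dist_triangle _ _ _).trans ((add_le_add ih (hstep m)).trans_eq ?_)
      rw [← ENNReal.ofReal_add (by linarith) (by positivity)]
      congr 1
      rw [pow_succ]
      field_simp
      ring
  have hlim : Tendsto (fun k : ℕ => 2 * R / 2 ^ k) atTop (𝓝 0) := by
    simpa [div_eq_mul_inv] using (tendsto_inv_atTop_zero.comp
      (tendsto_pow_atTop_atTop_of_one_lt (one_lt_two (α := ℝ)))).const_mul (2 * R)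
  have hcau : D.IsCauchy σ := by
    intro ε hε
    have h1 : Tendsto (fun k : ℕ => ENNReal.ofReal (2 * R / 2 ^ k)) atTop (𝓝 0) := by
      simpa using ENNReal.tendsto_ofReal hlim
    obtain ⟨N, hN⟩ := eventually_atTop.1 (h1.eventually (gt_mem_nhds hε))
    refine ⟨N, fun k m hk hkm => lt_of_le_of_lt ((hdist k m hkm).trans ?_) (hN k hk)⟩
    exact ENNReal.ofReal_le_ofReal (sub_le_self _ (by positivity))
  obtain ⟨z, hz⟩ := hD σ hcau
  have : LocallyCompactSpace M :=
    ChartedSpace.locallyCompactSpace (EuclideanSpace ℝ (Fin n)) M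
  obtain ⟨K, hK, hKz⟩ := exists_compact_mem_nhds z
  obtain ⟨η, hη, hball⟩ := D.exists_ball_subset hKz
  obtain ⟨k, hk1, hk2⟩ := ((hz.eventually (D.eventually_dist_lt z (half_pos hη))).and
    (hlim.eventually (gt_mem_nhds (half_pos hη)))).exists
  refine hσ k ⟨K, hK, fun y hy => hball y ((D.dist_triangle z (σ k) y).trans_lt ?_)⟩
  calc D.dist z (σ k) + D.dist (σ k) y
      < ENNReal.ofReal (η / 2) + ENNReal.ofReal (R / 2 ^ k) := ENNReal.add_lt_add hk1.1 hy
    _ ≤ ENNReal.ofReal (η / 2) + ENNReal.ofReal (η / 2) := by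
      have h3 : R / 2 ^ k ≤ 2 * R / 2 ^ k := by
        gcongr
        linarith
      exact add_le_add le_rfl (ENNReal.ofReal_le_ofReal (by linarith))
    _ = ENNReal.ofReal η := by
      rw [← ENNReal.ofReal_add (by positivity) (by positivity), add_halves]

theorem IsComplete.compactSpace [T2Space M] (hD : D.IsComplete) (hb : D.IsBounded) :
    CompactSpace M := by
  obtain ⟨x₀, r, hr⟩ := hb
  obtain ⟨K, hK, hball⟩ := hD.hasCompactBall x₀ (R := r + 1) (by positivity)
  refine ⟨?_⟩
  rwa [← eq_univ_of_forall fun y => hball y ((hr y).trans ?_)]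
  rw [← ENNReal.ofReal_coe_nnreal]
  exact (ENNReal.ofReal_lt_ofReal_iff (by positivity)).2 (lt_add_one _)

end StationaryData

end Compactness

/-! ### Terminal sets over a compact base -/

section Terminal

variable {n : ℕ} {M : Type*} [TopologicalSpace M] [ChartedSpace (EuclideanSpace ℝ (Fin n)) M]
  [IsManifold (𝓡 n) ∞ M]

namespace SplitMetric

variable {D : StationaryData n M} {g : SplitMetric n M} {α : ℝ → ℝ}

/-- Any two events of an indecomposable past set `P` have a common chronological successor in `P`:
for `p ∈ P`, the set `P` is the union of the pasts of `P ∩ I⁺(p)` and of `P \ I⁺(p)`, and `p` does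
not belong to the second one. -/
theorem IsIP.directed (hg : g.IsSpacetime) (hcl : D.gcl.Prec g) {P : Set (ℝ × M)} (hP : g.IsIP P)
    {p q : ℝ × M} (hp : p ∈ P) (hq : q ∈ P) : ∃ r ∈ P, g.Chron p r ∧ g.Chron q r := by
  have hpast : g.past P = P := hP.1.2.symm
  set A := g.past (P ∩ {r | g.Chron p r}) with hA
  set B := g.past (P \ {r | g.Chron p r}) with hB
  have hpB : p ∉ B := fun ⟨r, hr, hpr⟩ => hr.2 hpr
  have hAB : P = A ∪ B := by
    refine Subset.antisymm (fun x hx => ?_) (union_subset ?_ ?_)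
    · rw [← hpast] at hx
      obtain ⟨r, hr, hxr⟩ := hx
      by_cases h : g.Chron p r
      · exact Or.inl ⟨r, ⟨hr, h⟩, hxr⟩
      · exact Or.inr ⟨r, ⟨hr, h⟩, hxr⟩
    · exact (past_mono inter_subset_left).trans hpast.subset
    · exact (past_mono sdiff_subset).trans hpast.subset
  have hpA : p ∈ A := by
    rw [hAB] at hp
    exact hp.resolve_right hpB
  have hAP : A = P := by
    rcases B.eq_empty_or_nonempty with h | h
    · rw [hAB, h, union_empty]
    · refine (hP.2 A B ⟨⟨p, hpA⟩, (past_past_eq hg hcl _).symm⟩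
        ⟨h, (past_past_eq hg hcl _).symm⟩ hAB).resolve_right fun h' => hpB ?_
      rw [h']
      exact hp
  rw [← hAP] at hq
  obtain ⟨r, hr, hqr⟩ := hq
  exact ⟨r, hr.1, hr.2, hqr⟩

/-- Timelike curves can be shifted into the past by a time `δ e^{-K(t - t₀)}`, where `K` is a
Lipschitz constant of the slope in time (Gronwall). In this way a shift of the initial point by `δ`
leaves a definite shift of the end point. -/
theorem Chron.shift (hg : g.IsSpacetime) {r₀ r : ℝ × M} {K δ Ω : ℝ} (hK : 0 ≤ K) (hδ : 0 ≤ δ)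
    (hlip : ∀ q : ℝ × M, (q = r₀ ∨ g.Chron r₀ q) → r₀.1 ≤ q.1 → q.1 ≤ Ω → ∀ η ∈ Icc 0 δ,
      ∀ v, g.slope (q.1 - η) q.2 v ≤ (1 + K * η) * g.slope q.1 q.2 v)
    (hmono : ∀ p q, g.Chron p q → p.1 < q.1) (h : g.Chron r₀ r) (hr : r.1 ≤ Ω) :
    g.Chron (r₀.1 - δ, r₀.2) (r.1 - δ * Real.exp (-(K * (r.1 - r₀.1))), r.2) := by
  have hseg : ∀ q r : ℝ × M, (q = r₀ ∨ g.Chron r₀ q) → g.TimelikeSegment q r → r.1 ≤ Ω →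
      g.TimelikeSegment (q.1 - δ * Real.exp (-(K * (q.1 - r₀.1))), q.2)
        (r.1 - δ * Real.exp (-(K * (r.1 - r₀.1))), r.2) := by
    rintro q r hq ⟨τ, c, a, b, hab, rfl, rfl, hs⟩ hr
    refine ⟨fun s => τ s - δ * Real.exp (-(K * (τ s - r₀.1))), c, a, b, hab, rfl, rfl,
      fun s hs' => ?_⟩
    obtain ⟨h1, h2, h3⟩ := hs s hs'
    have hpt : (τ s, c s) = r₀ ∨ g.Chron r₀ (τ s, c s) := by
      rcases hs'.1.eq_or_lt with rfl | has
      · exact hq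
      · have h4 : g.Chron (τ a, c a) (τ s, c s) := Relation.TransGen.single
          ⟨τ, c, a, s, has, rfl, rfl, fun u hu => hs u ⟨hu.1, hu.2.trans hs'.2⟩⟩
        rcases hq with rfl | hq
        · exact Or.inr h4
        · exact Or.inr (hq.trans h4)
    have hτr : τ s ≤ Ω := by
      rcases hs'.2.eq_or_lt with rfl | hsb
      · exact hr
      · have h4 : g.Chron (τ s, c s) (τ b, c b) := Relation.TransGen.single
          ⟨τ, c, s, b, hsb, rfl, rfl, fun u hu => hs u ⟨hs'.1.trans hu.1, hu.2⟩⟩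
        exact (hmono _ _ h4).le.trans hr
    have hr₀ : r₀.1 ≤ τ s := by
      rcases hpt with h4 | h4
      · rw [← h4]
      · exact (hmono _ _ h4).le
    set η := δ * Real.exp (-(K * (τ s - r₀.1))) with hη
    have hη0 : 0 ≤ η := mul_nonneg hδ (Real.exp_pos _).le
    have hηδ : η ≤ δ := mul_le_of_le_one_right hδ
      (Real.exp_le_one_iff.2 (neg_nonpos.2 (mul_nonneg hK (sub_nonneg.2 hr₀))))
    refine ⟨?_, h2, hg.futureTimelike_iff.2 ?_⟩
    · exact h1.sub (contDiffAt_const.mul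
        (Real.contDiff_exp.contDiffAt.comp s
          ((contDiffAt_const.mul (h1.sub contDiffAt_const)).neg)))
    · have hd : HasDerivAt τ (deriv τ s) s := (h1.differentiableAt (by simp)).hasDerivAt
      have hd' : HasDerivAt (fun s => τ s - δ * Real.exp (-(K * (τ s - r₀.1))))
          (deriv τ s - δ * (Real.exp (-(K * (τ s - r₀.1))) * -(K * deriv τ s))) s :=
        hd.fun_sub ((((hd.sub_const r₀.1).const_mul K).fun_neg.exp).const_mul δ)
      rw [hd'.deriv]
      have h5 := hlip (τ s, c s) hpt hr₀ hτr η ⟨hη0, hηδ⟩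
        (mfderiv 𝓘(ℝ, ℝ) (𝓡 n) c s (1 : ℝ))
      have h6 := hg.futureTimelike_iff.1 h3
      have h7 : 0 < 1 + K * η := by positivity
      calc _ ≤ _ := h5
        _ < (1 + K * η) * deriv τ s := mul_lt_mul_of_pos_left h6 h7
        _ = _ := by rw [hη]; ring
  induction h with
  | single h =>
    have := hseg r₀ _ (Or.inl rfl) h hr
    simp only [sub_self, mul_zero, neg_zero, Real.exp_zero, mul_one] at this
    exact Relation.TransGen.single this
  | @tail q r h h' ih =>
    have hqr := hmono _ _ (Relation.TransGen.single h')
    exact Relation.TransGen.tail (ih (hqr.le.trans hr)) (hseg q r (Or.inr h) h' hr)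

/-- Just before the time `Ω`, timelike curves can only cover small distances. -/
theorem exists_pos_integral_lt (hα : Continuous α) (hα_pos : ∀ t, 0 < α t) (Ω : ℝ) {η : ℝ}
    (hη : 0 < η) : ∃ ε > 0, ∀ t u, Ω - ε ≤ t → t ≤ u → u ≤ Ω → ∫ s in t..u, 1 / α s < η := by
  have hcont : Continuous fun s => 1 / α s := continuous_const.div hα fun s => (hα_pos s).ne'
  have hprim : Continuous fun t => ∫ s in t..Ω, 1 / α s := by
    simp_rw [intervalIntegral.integral_symm Ω]
    exact (intervalIntegral.continuous_primitive (fun a b => hcont.intervalIntegrable a b) Ω).neg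
  obtain ⟨ε, hε, hε'⟩ := Metric.eventually_nhds_iff_ball.1
    ((hprim.tendsto Ω).eventually (gt_mem_nhds (by simpa using hη)))
  refine ⟨ε / 2, half_pos hε, fun t u ht htu hu => ?_⟩
  have h1 := hε' t (by
    rw [Metric.mem_ball, Real.dist_eq, abs_sub_lt_iff]
    constructor <;> linarith)
  have h2 := intervalIntegral.integral_add_adjacent_intervals
    (hcont.intervalIntegrable (μ := MeasureTheory.volume) t u) (hcont.intervalIntegrable u Ω)
  have h3 : 0 ≤ ∫ s in u..Ω, 1 / α s :=
    intervalIntegral.integral_nonneg hu fun s _ => (one_div_pos.2 (hα_pos s)).le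
  linarith

/-- Over a compact base, an indecomposable past set with times bounded above is the past of an
event `(Ω, z)`: here `Ω` is the supremum of its times and `z` a cluster point of the positions of
its events along the chronological order. -/
theorem IsIP.eq_past_singleton [T2Space M] [CompactSpace M] (hα : Continuous α)
    (hα_pos : ∀ t, 0 < α t) (hg : g.IsSpacetime) (hcl : D.gcl.Prec g) (hop : g.Prec (D.gop α))
    {P : Set (ℝ × M)} (hP : g.IsIP P) (hbdd : BddAbove (Prod.fst '' P)) :
    ∃ p : ℝ × M, P = g.past {p} := by
  have hmono : ∀ p q, g.Chron p q → p.1 < q.1 := fun p q h =>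
    (h.lt_and_dist_le hα hα_pos hg hop).1
  have hpast : g.past P = P := hP.1.2.symm
  obtain ⟨p₀, hp₀⟩ := hP.1.1
  set Ω := sSup (Prod.fst '' P) with hΩ
  have hle : ∀ p ∈ P, p.1 ≤ Ω := fun p hp => le_csSup hbdd ⟨p, hp, rfl⟩
  obtain ⟨z, hz⟩ : (⋂ p : P, closure (Prod.snd '' {r | r ∈ P ∧ g.Chron p.1 r})).Nonempty := by
    have : Nonempty P := ⟨⟨p₀, hp₀⟩⟩
    refine IsCompact.nonempty_iInter_of_directed_nonempty_isCompact_isClosed _ ?_ ?_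
      (fun _ => isClosed_closure.isCompact) (fun _ => isClosed_closure)
    · rintro ⟨p, hp⟩ ⟨q, hq⟩
      obtain ⟨r, hr, hpr, hqr⟩ := hP.directed hg hcl hp hq
      exact ⟨⟨r, hr⟩, closure_mono (image_mono fun s hs => ⟨hs.1, hpr.trans hs.2⟩),
        closure_mono (image_mono fun s hs => ⟨hs.1, hqr.trans hs.2⟩)⟩
    · rintro ⟨p, hp⟩
      obtain ⟨r, hr, hpr, -⟩ := hP.directed hg hcl hp hp
      exact ⟨r.2, subset_closure ⟨r, ⟨hr, hpr⟩, rfl⟩⟩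
  rw [mem_iInter] at hz
  have happrox : ∀ p ∈ P, ∀ ε > 0, ∃ r ∈ P, g.Chron p r ∧ D.dist z r.2 < ENNReal.ofReal ε ∧
      D.dist r.2 z < ENNReal.ofReal ε ∧ Ω - ε < r.1 := by
    intro p hp ε hε
    obtain ⟨_, ⟨p', hp', rfl⟩, hp'Ω⟩ := exists_lt_of_lt_csSup (⟨p₀.1, p₀, hp₀, rfl⟩ :
      (Prod.fst '' P).Nonempty) (show Ω - ε < sSup (Prod.fst '' P) by linarith)
    obtain ⟨q, hq, hpq, hp'q⟩ := hP.directed hg hcl hp hp'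
    obtain ⟨_, hx, r, ⟨hr, hqr⟩, rfl⟩ := mem_closure_iff_nhds.1 (hz ⟨q, hq⟩) _
      (D.eventually_dist_lt z hε)
    exact ⟨r, hr, hpq.trans hqr, hx.1, hx.2, hp'Ω.trans (hmono _ _ (hp'q.trans hqr))⟩
  refine ⟨(Ω, z), Subset.antisymm (fun p hp => ?_) ?_⟩
  · obtain ⟨K, hK⟩ := hg.exists_slope_le hα_pos hop Ω z
    -- a product neighbourhood of `(Ω, z)` on which the slope is Lipschitz in time
    rw [nhds_prod_eq, nhds_prod_eq] at hK
    obtain ⟨pa, hpa, pb, hpb, hab⟩ := eventually_prod_iff.1 hK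
    obtain ⟨pb₁, hpb₁, pb₂, hpb₂, hb⟩ := eventually_prod_iff.1 hpb
    obtain ⟨ρ, hρ, hρ'⟩ := Metric.eventually_nhds_iff_ball.1 (hpa.and hpb₁)
    obtain ⟨η, hη, hη'⟩ := D.exists_ball_subset hpb₂
    obtain ⟨ε, hε, hε'⟩ := exists_pos_integral_lt hα hα_pos Ω (half_pos hη)
    obtain ⟨r₀, hr₀, hpr₀, hzr₀, -, hr₀Ω⟩ := happrox p hp (min ε (min (ρ / 2) (η / 2)))
      (lt_min hε (lt_min (half_pos hρ) (half_pos hη)))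
    have hr₀ε : Ω - ε ≤ r₀.1 := by linarith [min_le_left ε (min (ρ / 2) (η / 2))]
    have hr₀ρ : Ω - ρ / 2 < r₀.1 := by
      linarith [(min_le_right ε (min (ρ / 2) (η / 2))).trans (min_le_left _ _)]
    have hr₀η : D.dist z r₀.2 < ENNReal.ofReal (η / 2) := hzr₀.trans_le
      (ENNReal.ofReal_le_ofReal ((min_le_right ε (min (ρ / 2) (η / 2))).trans (min_le_right _ _)))
    obtain ⟨δ, ⟨hpδ, hδρ⟩, hδ0⟩ := (((hpr₀.eventually_past hg).and
      (gt_mem_nhds (half_pos hρ))).filter_mono nhdsWithin_le_nhds |>.and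
      (self_mem_nhdsWithin : Ioi (0 : ℝ) ∈ 𝓝[>] 0)).exists
    replace hδ0 : 0 < δ := hδ0
    have hnn : ∀ t x v, 0 ≤ g.slope t x v := fun t x v =>
      (mul_nonneg (hα_pos t).le (D.F_nonneg x v)).trans (D.mul_F_le_slope hα_pos hg hop t x v)
    have hlip : ∀ q : ℝ × M, (q = r₀ ∨ g.Chron r₀ q) → r₀.1 ≤ q.1 → q.1 ≤ Ω → ∀ η ∈ Icc 0 δ,
        ∀ v, g.slope (q.1 - η) q.2 v ≤ (1 + max K 0 * η) * g.slope q.1 q.2 v := by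
      intro q hq hr₀q hqΩ θ hθ v
      have hdist : D.dist r₀.2 q.2 < ENNReal.ofReal (η / 2) := by
        rcases hq with rfl | hq
        · simpa [D.dist_self] using hη
        · obtain ⟨h1, h2⟩ := hq.lt_and_dist_le hα hα_pos hg hop
          exact h2.trans_lt ((ENNReal.ofReal_lt_ofReal_iff (half_pos hη)).2
            (hε' _ _ hr₀ε h1.le hqΩ))
      have hmem : pb₂ q.2 := hη' q.2 (by
        refine (D.dist_triangle z r₀.2 q.2).trans_lt ((ENNReal.add_lt_add hr₀η hdist).trans_eq ?_)
        rw [← ENNReal.ofReal_add (by positivity) (by positivity), add_halves])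
      have h1 := (hρ' q.1 (by
        rw [Metric.mem_ball, Real.dist_eq, abs_sub_lt_iff]
        constructor <;> linarith)).1
      have h2 := (hρ' (q.1 - θ) (by
        rw [Metric.mem_ball, Real.dist_eq, abs_sub_lt_iff]
        constructor <;> linarith [hθ.1, hθ.2])).2
      have h3 := hab h1 (hb h2 hmem) v
      simp only [sub_sub_cancel, abs_of_nonneg hθ.1] at h3
      refine h3.trans (mul_le_mul_of_nonneg_right ?_ (hnn _ _ _))
      linarith [mul_le_mul_of_nonneg_right (le_max_left K 0) hθ.1]
    -- all events of `P` after `r₀` can be moved into the past by at least `η₀`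
    set η₀ := δ * Real.exp (-(max K 0 * (Ω - r₀.1))) with hη₀
    have hη₀pos : 0 < η₀ := mul_pos hδ0 (Real.exp_pos _)
    obtain ⟨r, hr, hr₀r, -, hrz, -⟩ := happrox r₀ hr₀ η₀ hη₀pos
    have hshift := hr₀r.shift hg (le_max_right K 0) hδ0.le hlip hmono (hle r hr)
    refine ⟨_, rfl, (hpδ.trans hshift).trans (chron_of_dist_lt hg hcl (hrz.trans_le
      (ENNReal.ofReal_le_ofReal ?_)))⟩
    have h1 : η₀ ≤ δ * Real.exp (-(max K 0 * (r.1 - r₀.1))) := by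
      refine mul_le_mul_of_nonneg_left (Real.exp_le_exp.2 (neg_le_neg ?_)) hδ0.le
      exact mul_le_mul_of_nonneg_left (by linarith [hle r hr]) (le_max_right K 0)
    linarith [hle r hr]
  · rintro p ⟨_, rfl, hp⟩
    obtain ⟨δ, hδ, hδ0⟩ := ((hp.eventually_past hg).filter_mono nhdsWithin_le_nhds |>.and
      (self_mem_nhdsWithin : Ioi (0 : ℝ) ∈ 𝓝[>] 0)).exists
    replace hδ0 : 0 < δ := hδ0
    obtain ⟨r, hr, -, hzr, -, hrΩ⟩ := happrox p₀ hp₀ (δ / 2) (half_pos hδ0)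
    rw [← hpast]
    refine ⟨r, hr, hδ.trans (chron_of_dist_lt hg hcl (hzr.trans_le
      (ENNReal.ofReal_le_ofReal ?_)))⟩
    simp only
    linarith

/-- If `M` is a forward ball, every event lies in the past of all sufficiently late events. -/
theorem IsPastSet.eq_univ_of_not_bddAbove [ConnectedSpace M] (hg : g.IsSpacetime)
    (hcl : D.gcl.Prec g) (hb : D.IsBounded) {P : Set (ℝ × M)} (hP : g.IsPastSet P)
    (h : ¬ BddAbove (Prod.fst '' P)) : P = univ := by
  refine eq_univ_of_forall fun p => ?_
  obtain ⟨x₀, r, hr⟩ := hb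
  obtain ⟨_, ⟨q, hq, rfl⟩, hpq⟩ := not_bddAbove_iff.1 h (p.1 + (D.dist p.2 x₀).toReal + r)
  rw [hP.2]
  refine ⟨q, hq, chron_of_dist_lt hg hcl (D.dist_lt_ofReal_iff.2 ?_)⟩
  have h1 : (D.dist x₀ q.2).toReal ≤ r := ENNReal.toReal_le_coe_of_le_coe (hr _).le
  have h2 := D.toReal_dist_triangle p.2 x₀ q.2
  linarith

theorem futureBoundary_eq_singleton_univ [T2Space M] [CompactSpace M] [ConnectedSpace M]
    (hα : Continuous α) (hα_pos : ∀ t, 0 < α t) (hg : g.IsSpacetime) (hcl : D.gcl.Prec g)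
    (hop : g.Prec (D.gop α)) (hb : D.IsBounded) : g.futureBoundary = {univ} := by
  refine Subset.antisymm (fun P hP => ?_)
    (singleton_subset_iff.2 (univ_mem_futureBoundary hα hα_pos hg hcl hop))
  by_cases h : BddAbove (Prod.fst '' P)
  · exact absurd (hP.1.eq_past_singleton hα hα_pos hg hcl hop h) hP.2
  · exact hP.1.1.eq_univ_of_not_bddAbove hg hcl hb h

end SplitMetric

end Terminal

end Isocausal

end

theorem mainTheorem7 {n : ℕ} {M : Type*} [TopologicalSpace M]
    [ChartedSpace (EuclideanSpace ℝ (Fin n)) M] [IsManifold (𝓡 n) ∞ M]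
    [T2Space M] [SecondCountableTopology M] [ConnectedSpace M]
    (D : Isocausal.StationaryData n M) (α : ℝ → ℝ) (hα : ContDiff ℝ ∞ α) (hα_pos : ∀ t, 0 < α t)
    (g : Isocausal.SplitMetric n M) (hg : g.IsSpacetime)
    (hcl : D.gcl.Prec g) (hop : g.Prec (D.gop α)) :
    (D.IsBounded →
      D.properBusemannBoundary = ∅ ∧
      Isocausal.ContainsCone g (fun (Ω : ℝ) (x : D.cauchyBoundary) => D.cauchyFun Ω x.1) ∧
      (D.IsComplete → CompactSpace M ∧ g.futureBoundary = {univ})) ∧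
    (D.IsComplete → MeasureTheory.IntegrableOn (fun s => 1 / α s - 1) (Ioi 0) →
      D.cauchyBoundary = ∅ ∧
      ∀ b : D.properBusemannBoundary → D.BusemannFun,
        (∀ ξ, Quotient.mk D.busSetoid (b ξ) = ξ.1) →
        Isocausal.ContainsCone g
          (fun (k : ℝ) (ξ : D.properBusemannBoundary) (y : M) => (b ξ).1 y + k)) := by
  refine ⟨fun hb => ⟨Isocausal.StationaryData.properBusemannBoundary_eq_empty hb,
    Isocausal.SplitMetric.containsCone_cauchyBoundary hα.continuous hα_pos hg hcl hop,
    fun hc => ?_⟩, fun hc hint => ⟨hc.cauchyBoundary_eq_empty, fun b hb =>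
    Isocausal.SplitMetric.containsCone_properBusemannBoundary hα.continuous hα_pos hint hg hcl hop
      b hb⟩⟩
  have := hc.compactSpace hb
  exact ⟨this,
    Isocausal.SplitMetric.futureBoundary_eq_singleton_univ hα.continuous hα_pos hg hcl hop hb⟩
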